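/- Write $\log$ for $\log_2$. For a finite poset $P$ let $\mathrm{ma}(P)$ be the number of maximal antichains of $P$, and for a finite graph $G$ let $\mathrm{mis}(G)$ be the number of (inclusion-)maximal independent sets of $G$. Let $\mathcal{B}_n$ be the collection of subsets of $\{1,\dots,n\}$ ordered by containment; let $Q_n$ be the graph with vertex set $\{0,1\}^n$ in which two vertices are adjacent if they differ in exactly one coordinate; and, for $0\le k\le n-1$, let $\mathcal{B}_{n,k}$ be the subgraph of $Q_n$ induced by the strings with exactly $k$ or exactly $k+1$ ones. Then, as $n\to\infty$: (a) $\log \mathrm{ma}(\mathcal{B}_n) = (1+o(1))\binom{n-1}{\lfloor n/2\rfloor}$; (b) $\log \mathrm{mis}(Q_n) = (1+o(1))\,2^{n-2}$; (c) $\log \mathrm{mis}(\mathcal{B}_{n,k}) = (1+o(1))\binom{n-1}{k}$, where the $o(1)$ tends to $0$ as $n\to\infty$ uniformly in $k\in\{0,\dots,n-1\}$; that is, for every $\varepsilon>0$ there is $N$ such that $\left|\log \mathrm{mis}(\mathcal{B}_{n,k})-\binom{n-1}{k}\right|\le\varepsilon\binom{n-1}{k}$ for all $n\ge N$ and all $0\le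 k\le n-1$. -/

import Mathlib

open Filter Asymptotics

/-- The number of maximal antichains of a (finite) poset `P`. -/
noncomputable def numMaxAntichains (P : Type*) [PartialOrder P] : ℕ :=
  {s : Set P | IsMaxAntichain (· ≤ ·) s}.ncard

/-- The number of inclusion-maximal independent sets of a graph `G` on a (finite) vertex set. -/
noncomputable def mis {V : Type*} (G : SimpleGraph V) : ℕ :=
  {s : Set V | Maximal G.IsIndepSet s}.ncard

/-- The graph of the `n`-cube: the vertices are the binary strings of length `n`, and two of them
are adjacent if they differ in exactly one coordinate. -/
def cubeGraph (n : ℕ) : SimpleGraph (Fin n → Bool) where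
  Adj x y := hammingDist x y = 1
  symm := ⟨fun x y h => by rw [hammingDist_comm]; exact h⟩
  loopless := ⟨fun x h => by simp at h⟩

/-- The weight of a binary string: its number of ones. -/
def weight {n : ℕ} (x : Fin n → Bool) : ℕ :=
  (Finset.univ.filter fun i => x i = true).card

/-- The subgraph of the `n`-cube induced by the strings of weight `k` and `k + 1`. -/
def cubeLevels (n k : ℕ) :
    SimpleGraph {x : Fin n → Bool | weight x = k ∨ weight x = k + 1} :=
  (cubeGraph n).induce {x : Fin n → Bool | weight x = k ∨ weight x = k + 1}

/-! The lower bounds come from induced matchings. The pairs `s`, `insert 0 s`, with `s` avoiding `0`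
and of even size for the cube, of fixed size for two levels and for antichains, span no other edges.
Choosing one end of each pair and extending gives distinct maximal independent sets
(`two_pow_le_card_maxIndep`).

The upper bounds are a container argument. A maximal independent set I has a fingerprint S ⊆ I,
chosen greedily, such that no member of I has φ neighbours outside the neighbourhood of S
(`exists_fingerprint`). Each member of S accounts for φ new vertices, so S is small, and with φ a
small multiple of n the choice of S costs a negligible number of bits. What remains of I lies in a
container X determined by S, and is still maximal independent there.

In the bipartite case a maximal independent subset of X is determined by its trace on either side of
X, and double counting edges bounds the smaller side by about the size of the matching
(`card_maxIndep_bipartite_le`). Levels k close to 0 or n are handled instead by recording the trace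
on one whole level.

Maximal antichains are maximal independent sets of the comparability graph. The members of size
above 3n/4 are recorded outright, and fingerprints are taken with respect to upward neighbourhoods.
The containers are then convex families with few members above each member. A flow through the
levels bounds such a family by nearly the middle binomial coefficient (`card_le_of_ordConnected`),
and branching on a minimal element shows that a convex family X has at most 2^(|X|/2) maximal
antichains (`card_maxIndep_sq_le_of_ordConnected`). Half the middle binomial coefficient is at most
the main term. -/

open Finset

/-! ### Maximal independent sets: traces, fingerprints, induced matchings -/

section MaxIndep

variable {V W : Type*}

open Classical in
/-- The maximal independent sets of the subgraph of `G` induced by the finite set `F`. -/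
noncomputable def maxIndep (G : SimpleGraph V) (F : Finset V) : Finset (Finset V) :=
  F.powerset.filter fun I => (∀ x ∈ I, ∀ y ∈ I, ¬ G.Adj x y) ∧
    ∀ x ∈ F, x ∉ I → ∃ y ∈ I, G.Adj x y

theorem mem_maxIndep {G : SimpleGraph V} {F I : Finset V} :
    I ∈ maxIndep G F ↔ I ⊆ F ∧ (∀ x ∈ I, ∀ y ∈ I, ¬ G.Adj x y) ∧
      ∀ x ∈ F, x ∉ I → ∃ y ∈ I, G.Adj x y := by
  simp [maxIndep]

theorem maximal_isIndepSet_iff (G : SimpleGraph V) (s : Set V) :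
    Maximal G.IsIndepSet s ↔ (∀ x ∈ s, ∀ y ∈ s, ¬ G.Adj x y) ∧
      ∀ x, x ∉ s → ∃ y ∈ s, G.Adj x y := by
  have key : ∀ s : Set V, G.IsIndepSet s ↔ ∀ x ∈ s, ∀ y ∈ s, ¬ G.Adj x y := by
    intro s
    constructor
    · intro h x hx y hy hxy
      exact h hx hy hxy.ne hxy
    · intro h x hx y hy _
      exact h x hx y hy
  constructor
  · intro h
    refine ⟨(key s).1 h.prop, fun x hx => ?_⟩
    by_contra! hcon
    have hins : G.IsIndepSet (insert x s) := by
      rw [key]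
      rintro u (rfl | hu) v (rfl | hv)
      · exact G.loopless.irrefl _
      · exact hcon v hv
      · exact fun h' => hcon u hu h'.symm
      · exact (key s).1 h.prop u hu v hv
    exact hx (h.le_of_ge hins (Set.subset_insert x s) (Set.mem_insert x s))
  · rintro ⟨h1, h2⟩
    refine ⟨(key s).2 h1, fun t ht hst x hx => ?_⟩
    by_contra hxs
    obtain ⟨y, hy, hxy⟩ := h2 x hxs
    exact (key t).1 ht x hx y (hst hy) hxy

/-- Counting maximal independent sets through an embedding with image `F`. -/
theorem mis_eq_card_maxIndep [Finite V] (G : SimpleGraph V) (H : SimpleGraph W)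
    (e : V → W) (he : Function.Injective e) (hadj : ∀ x y, H.Adj (e x) (e y) ↔ G.Adj x y)
    (F : Finset W) (hF : ∀ w, w ∈ F ↔ ∃ v, e v = w) : mis G = #(maxIndep H F) := by
  classical
  have himg : (fun s : Set V => e '' s) '' {s : Set V | Maximal G.IsIndepSet s} =
      (fun I : Finset W => (I : Set W)) '' (maxIndep H F : Set (Finset W)) := by
    ext t
    constructor
    · rintro ⟨s, hs, rfl⟩
      rw [Set.mem_ofPred_eq, maximal_isIndepSet_iff] at hs
      have hfin : (e '' s).Finite := (Set.toFinite s).image e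
      refine ⟨hfin.toFinset, ?_, by simp⟩
      rw [mem_coe, mem_maxIndep]
      refine ⟨?_, ?_, ?_⟩
      · intro w hw
        obtain ⟨v, -, rfl⟩ := hfin.mem_toFinset.1 hw
        exact (hF _).2 ⟨v, rfl⟩
      · intro x hx y hy
        obtain ⟨u, hu, rfl⟩ := hfin.mem_toFinset.1 hx
        obtain ⟨v, hv, rfl⟩ := hfin.mem_toFinset.1 hy
        rw [hadj]
        exact hs.1 u hu v hv
      · intro x hx hxs
        obtain ⟨u, rfl⟩ := (hF x).1 hx
        have hu : u ∉ s := fun hu => hxs (hfin.mem_toFinset.2 ⟨u, hu, rfl⟩)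
        obtain ⟨v, hv, huv⟩ := hs.2 u hu
        exact ⟨e v, hfin.mem_toFinset.2 ⟨v, hv, rfl⟩, (hadj _ _).2 huv⟩
    · rintro ⟨I, hI, rfl⟩
      rw [mem_coe, mem_maxIndep] at hI
      obtain ⟨hIF, hind, hmax⟩ := hI
      refine ⟨e ⁻¹' (I : Set W), ?_, ?_⟩
      · rw [Set.mem_ofPred_eq, maximal_isIndepSet_iff]
        refine ⟨fun x hx y hy => ?_, fun x hx => ?_⟩
        · rw [← hadj]
          exact hind _ hx _ hy
        · obtain ⟨y, hy, hxy⟩ := hmax (e x) ((hF _).2 ⟨x, rfl⟩) hx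
          obtain ⟨v, rfl⟩ := (hF y).1 (hIF hy)
          exact ⟨v, hy, (hadj _ _).1 hxy⟩
      · refine Set.image_preimage_eq_of_subset fun w hw => ?_
        obtain ⟨v, hv⟩ := (hF w).1 (hIF hw)
        exact ⟨v, hv⟩
  rw [mis, ← Set.ncard_image_of_injective _ he.image_injective, himg,
    Set.ncard_image_of_injective _ coe_injective, Set.ncard_coe_finset]

/-- The neighbour that blocks an excluded vertex belongs to `I`, so it survives in any container `X`
of `I`. -/
theorem maxIndep_restrict {G : SimpleGraph V} {F X I : Finset V} (hI : I ∈ maxIndep G F)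
    (hXF : X ⊆ F) (hIX : I ⊆ X) : I ∈ maxIndep G X := by
  rw [mem_maxIndep] at hI ⊢
  exact ⟨hIX, hI.2.1, fun x hx => hI.2.2 x (hXF hx)⟩

/-- If `F \ A` is independent, a maximal independent set of `F` is determined by its trace
on `A`. -/
theorem card_maxIndep_le_two_pow [DecidableEq V] {G : SimpleGraph V} {F A : Finset V}
    (hB : ∀ x ∈ F, x ∉ A → ∀ y ∈ F, y ∉ A → ¬ G.Adj x y) :
    #(maxIndep G F) ≤ 2 ^ #A := by
  rw [← card_powerset]
  refine card_le_card_of_injOn (fun I => I ∩ A) (fun I _ => by simp) ?_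
  -- A point x of I \ I' is blocked by some y in I'. They are not both outside `A`, and whichever
  -- lies in `A` belongs to both sets, a contradiction.
  have key : ∀ I ∈ maxIndep G F, ∀ I' ∈ maxIndep G F, I ∩ A = I' ∩ A → I ⊆ I' := by
    intro I hI I' hI' h x hx
    rw [mem_maxIndep] at hI hI'
    by_contra hx'
    obtain ⟨y, hy, hxy⟩ := hI'.2.2 x (hI.1 hx) hx'
    by_cases hyA : y ∈ A
    · have : y ∈ I ∩ A := h ▸ mem_inter.2 ⟨hy, hyA⟩
      exact hI.2.1 x hx y (mem_inter.1 this).1 hxy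
    · by_cases hxA : x ∈ A
      · have : x ∈ I' ∩ A := h ▸ mem_inter.2 ⟨hx, hxA⟩
        exact hx' (mem_inter.1 this).1
      · exact hB x (hI.1 hx) hxA y (hI'.1 hy) hyA hxy
  intro I hI I' hI' h
  exact Subset.antisymm (key I hI I' hI' h) (key I' hI' I hI h.symm)

/-- A small subset `S` of `I` whose neighbourhood captures almost all of the neighbourhood of
every member of `I`. -/
theorem exists_fingerprint [DecidableEq W] (N : V → Finset W) (I : Finset V) {φ : ℕ} (hφ : 0 < φ) :
    ∃ S ⊆ I, φ * #S ≤ #(S.biUnion N) ∧ ∀ u ∈ I, #(N u \ S.biUnion N) < φ := by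
  classical
  -- Take `S` as large as possible subject to `φ * #S ≤ #(S.biUnion N)`: a member of `I`
  -- contributing φ new neighbours could be added to it.
  obtain ⟨S, hS, hmax⟩ := exists_max_image
    (I.powerset.filter fun S => φ * #S ≤ #(S.biUnion N)) card ⟨∅, by simp⟩
  simp only [mem_filter, mem_powerset] at hS hmax
  refine ⟨S, hS.1, hS.2, fun u hu => ?_⟩
  by_cases huS : u ∈ S
  · rw [sdiff_eq_empty_iff_subset.2 (subset_biUnion_of_mem N huS)]
    simpa
  by_contra! hcon
  have h1 := hmax (insert u S) ⟨insert_subset hu hS.1, ?_⟩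
  · rw [card_insert_of_notMem huS] at h1
    omega
  · rw [card_insert_of_notMem huS, biUnion_insert, ← sdiff_union_self_eq_union,
      card_union_of_disjoint sdiff_disjoint, mul_add]
    omega

/-- The number of subsets of `Q` with at most `m` elements. -/
theorem card_small_subsets_le (Q : Finset V) (m : ℕ) {x : ℝ} (hx : 0 < x) (hx1 : x ≤ 1) :
    (#(Q.powerset.filter fun S => #S ≤ m) : ℝ) ≤ (1 + x) ^ #Q / x ^ m := by
  rw [le_div_iff₀ (by positivity)]
  calc (#(Q.powerset.filter fun S => #S ≤ m) : ℝ) * x ^ m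
      = ∑ _S ∈ Q.powerset.filter fun S => #S ≤ m, x ^ m := by simp
    _ ≤ ∑ S ∈ Q.powerset.filter fun S => #S ≤ m, x ^ #S := by
        refine sum_le_sum fun S hS => ?_
        exact pow_le_pow_of_le_one hx.le hx1 (mem_filter.1 hS).2
    _ ≤ ∑ S ∈ Q.powerset, x ^ #S :=
        sum_le_sum_of_subset_of_nonneg (filter_subset _ _) fun _ _ _ => by positivity
    _ = (1 + x) ^ #Q := by
        have := Finset.sum_pow_mul_eq_add_pow x 1 Q
        simp only [one_pow, mul_one] at this
        rw [this, add_comm]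

/-- The weight `x = 1 / n` is used: each chosen element costs log n bits, and the factor (1 +
1/n)^#Q costs at most 2 #Q / n, since 1 / log 2 < 2. -/
theorem logb_card_small_subsets_le (Q : Finset V) {m : ℕ} {c : ℝ} (hm : (m : ℝ) ≤ c)
    {n : ℕ} (hn : 1 ≤ n) :
    Real.logb 2 #(Q.powerset.filter fun S => #S ≤ m) ≤ 2 * #Q / n + c * Real.logb 2 n := by
  have hn' : (1 : ℝ) ≤ n := by exact_mod_cast hn
  have hx : (0 : ℝ) < 1 / n := by positivity
  have h0 : (0 : ℝ) < #(Q.powerset.filter fun S => #S ≤ m) := by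
    exact_mod_cast card_pos.2 ⟨∅, by simp⟩
  have h1 := card_small_subsets_le Q m hx (by rw [div_le_one (by positivity)]; exact hn')
  have hlogn : 0 ≤ Real.logb 2 n := Real.logb_nonneg one_lt_two hn'
  have hstep : Real.logb 2 (1 + 1 / n) ≤ 2 / n := by
    rw [Real.logb, div_le_iff₀ (Real.log_pos one_lt_two)]
    have h3 := Real.log_le_sub_one_of_pos (show (0 : ℝ) < 1 + 1 / n by positivity)
    have h4 := Real.log_two_gt_d9
    calc Real.log (1 + 1 / n) ≤ 1 / n := by linarith
      _ ≤ 2 / n * Real.log 2 := by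
        rw [div_mul_eq_mul_div]
        gcongr
        linarith
  calc Real.logb 2 #(Q.powerset.filter fun S => #S ≤ m)
      ≤ Real.logb 2 ((1 + 1 / n) ^ #Q / (1 / n) ^ m) :=
        Real.logb_le_logb_of_le one_lt_two h0 h1
    _ = #Q * Real.logb 2 (1 + 1 / n) + m * Real.logb 2 n := by
        rw [Real.logb_div (by positivity) (by positivity), Real.logb_pow, Real.logb_pow,
          one_div, Real.logb_inv]
        ring
    _ ≤ #Q * (2 / n) + c * Real.logb 2 n := by gcongr
    _ = _ := by ring

theorem exists_mem_maxIndep_superset {G : SimpleGraph V} {F J : Finset V} (hJF : J ⊆ F)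
    (hJ : ∀ x ∈ J, ∀ y ∈ J, ¬ G.Adj x y) : ∃ I ∈ maxIndep G F, J ⊆ I := by
  classical
  obtain ⟨I, hI, hmax⟩ := exists_max_image
    (F.powerset.filter fun I => J ⊆ I ∧ ∀ x ∈ I, ∀ y ∈ I, ¬ G.Adj x y) card
    ⟨J, by simpa [hJF] using hJ⟩
  simp only [mem_filter, mem_powerset] at hI hmax
  refine ⟨I, mem_maxIndep.2 ⟨hI.1, hI.2.2, fun x hx hxI => ?_⟩, hI.2.1⟩
  by_contra! hcon
  have h1 := hmax (insert x I) ⟨insert_subset hx hI.1, hI.2.1.trans (subset_insert _ _), ?_⟩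
  · rw [card_insert_of_notMem hxI] at h1
    omega
  · intro u hu v hv
    rcases mem_insert.1 hu with rfl | hu' <;> rcases mem_insert.1 hv with rfl | hv'
    · exact G.loopless.irrefl _
    · exact hcon v hv'
    · exact fun h' => hcon u hu' h'.symm
    · exact hI.2.2 u hu' v hv'

/-- An induced matching with `#M` edges yields `2 ^ #M` maximal independent sets. -/
theorem two_pow_le_card_maxIndep {ι : Type*} {G : SimpleGraph V} {F : Finset V}
    (M : Finset ι) (p q : ι → V) (hp : ∀ i ∈ M, p i ∈ F) (hq : ∀ i ∈ M, q i ∈ F)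
    (hpq : ∀ i ∈ M, ∀ j ∈ M, G.Adj (p i) (q j) ↔ i = j)
    (hpp : ∀ i ∈ M, ∀ j ∈ M, ¬ G.Adj (p i) (p j))
    (hqq : ∀ i ∈ M, ∀ j ∈ M, ¬ G.Adj (q i) (q j)) :
    2 ^ #M ≤ #(maxIndep G F) := by
  classical
  -- Take the `p`-end of the edges in `T` and the `q`-end of the others. Extensions for different
  -- `T` differ, since none can contain both ends of an edge.
  have hex : ∀ T ∈ M.powerset, ∃ I ∈ maxIndep G F, T.image p ∪ (M \ T).image q ⊆ I := by
    intro T hT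
    rw [mem_powerset] at hT
    refine exists_mem_maxIndep_superset ?_ ?_
    · intro x hx
      rcases mem_union.1 hx with hx | hx <;> obtain ⟨i, hi, rfl⟩ := mem_image.1 hx
      · exact hp i (hT hi)
      · exact hq i (mem_sdiff.1 hi).1
    · intro x hx y hy
      rcases mem_union.1 hx with hx | hx <;> obtain ⟨i, hi, rfl⟩ := mem_image.1 hx <;>
      rcases mem_union.1 hy with hy | hy <;> obtain ⟨j, hj, rfl⟩ := mem_image.1 hy
      · exact hpp i (hT hi) j (hT hj)
      · rw [hpq i (hT hi) j (mem_sdiff.1 hj).1]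
        rintro rfl
        exact (mem_sdiff.1 hj).2 hi
      · rw [G.adj_comm, hpq j (hT hj) i (mem_sdiff.1 hi).1]
        rintro rfl
        exact (mem_sdiff.1 hi).2 hj
      · exact hqq i (mem_sdiff.1 hi).1 j (mem_sdiff.1 hj).1
  choose! f hf hsub using hex
  rw [← card_powerset]
  refine card_le_card_of_injOn f hf ?_
  have key : ∀ T ∈ M.powerset, ∀ T' ∈ M.powerset, f T = f T' → T ⊆ T' := by
    intro T hT T' hT' h i hi
    by_contra hi'
    have hiM := mem_powerset.1 hT hi
    have h1 : p i ∈ f T := hsub T hT (mem_union_left _ (mem_image_of_mem p hi))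
    have h2 : q i ∈ f T := h ▸ hsub T' hT'
      (mem_union_right _ (mem_image_of_mem q (mem_sdiff.2 ⟨hiM, hi'⟩)))
    exact (mem_maxIndep.1 (hf T hT)).2.1 _ h1 _ h2 ((hpq i hiM i hiM).2 rfl)
  intro T hT T' hT' h
  exact Subset.antisymm (key T hT T' hT' h) (key T' hT' T hT h.symm)

end MaxIndep

/-! ### Containers in bipartite graphs -/

section Bipartite

variable {V : Type*}

open Classical in
-- With S the fingerprint of I ∩ A, the container consists of the u in `A` with fewer than φ
-- neighbours outside N(S), together with B \ N(S). Its two sides L and B \ N(S) satisfy a|L| + b|B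
-- \ N(S)| ≤ b|B| + φ|A|, so the smaller has at most `t` elements, and the trace on it determines I.
theorem card_maxIndep_bipartite_le [DecidableEq V] {G : SimpleGraph V} {A B : Finset V}
    (hA : ∀ x ∈ A, ∀ y ∈ A, ¬ G.Adj x y) (hB : ∀ x ∈ B, ∀ y ∈ B, ¬ G.Adj x y) {a b φ t : ℕ}
    (hφ : 0 < φ) (ha : ∀ u ∈ A, a ≤ #(B.filter fun y => G.Adj u y))
    (hb : ∀ y ∈ B, #(A.filter fun u => G.Adj u y) ≤ b)
    (ht : ∀ r : ℕ, (a + b) * r ≤ b * #B + φ * #A → r ≤ t) :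
    #(maxIndep G (A ∪ B)) ≤ #(A.powerset.filter fun S => #S ≤ #B / φ) * 2 ^ t := by
  set N : V → Finset V := fun u => B.filter fun y => G.Adj u y with hN
  set L : Finset V → Finset V := fun S => A.filter fun u => #(N u \ S.biUnion N) < φ with hL
  set X : Finset V → Finset V := fun S => L S ∪ (B \ S.biUnion N) with hX
  have hNB : ∀ S : Finset V, S.biUnion N ⊆ B := fun S =>
    biUnion_subset.2 fun u _ => filter_subset _ _
  have hLA : ∀ S, L S ⊆ A := fun S => filter_subset _ _
  have hXF : ∀ S, X S ⊆ A ∪ B := fun S => union_subset_union (hLA S) sdiff_subset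
  have hcover : maxIndep G (A ∪ B) ⊆
      (A.powerset.filter fun S => #S ≤ #B / φ).biUnion fun S => maxIndep G (X S) := by
    intro I hI
    obtain ⟨hIF, hind, hmax⟩ := mem_maxIndep.1 hI
    obtain ⟨S, hSI, hcard, hsmall⟩ := exists_fingerprint N (I ∩ A) hφ
    rw [mem_biUnion]
    refine ⟨S, ?_, maxIndep_restrict hI (hXF S) ?_⟩
    · rw [mem_filter, mem_powerset, Nat.le_div_iff_mul_le hφ, mul_comm]
      exact ⟨hSI.trans inter_subset_right, hcard.trans (card_le_card (hNB S))⟩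
    · intro x hx
      by_cases hxA : x ∈ A
      · exact mem_union_left _ (mem_filter.2 ⟨hxA, hsmall x (mem_inter.2 ⟨hx, hxA⟩)⟩)
      · refine mem_union_right _ (mem_sdiff.2 ⟨(mem_union.1 (hIF hx)).resolve_left hxA, ?_⟩)
        rw [mem_biUnion]
        rintro ⟨s, hs, hxs⟩
        exact hind s (mem_inter.1 (hSI hs)).1 x hx (mem_filter.1 hxs).2
  refine (card_le_card hcover).trans (card_biUnion_le_card_mul _ _ _ fun S _ => ?_)
  have h1 : #(maxIndep G (X S)) ≤ 2 ^ #(L S) := by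
    refine card_maxIndep_le_two_pow fun x hx hxL y hy hyL => hB x ?_ y ?_
    · exact (mem_sdiff.1 ((mem_union.1 hx).resolve_left hxL)).1
    · exact (mem_sdiff.1 ((mem_union.1 hy).resolve_left hyL)).1
  have h2 : #(maxIndep G (X S)) ≤ 2 ^ #(B \ S.biUnion N) := by
    refine card_maxIndep_le_two_pow fun x hx hxL y hy hyL => hA x ?_ y ?_
    · exact hLA S ((mem_union.1 hx).resolve_right hxL)
    · exact hLA S ((mem_union.1 hy).resolve_right hyL)
  -- Double count the edges between L and N(S): each u in L sends all but fewer than φ of its at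
  -- least a edges into N(S).
  have hedges : a * #(L S) ≤ φ * #(L S) + b * #(S.biUnion N) := by
    have h3 : ∀ u ∈ L S, a ≤ φ + #((S.biUnion N).filter fun y => G.Adj u y) := by
      intro u hu
      obtain ⟨huA, hu'⟩ := mem_filter.1 hu
      have h4 : #(N u) ≤ #(N u \ S.biUnion N) + #((S.biUnion N).filter fun y => G.Adj u y) := by
        refine le_trans (card_le_card fun y hy => ?_) (card_union_le (N u \ S.biUnion N)
          ((S.biUnion N).filter fun y => G.Adj u y))
        by_cases hyS : y ∈ S.biUnion N
        · exact mem_union_right _ (mem_filter.2 ⟨hyS, (mem_filter.1 hy).2⟩)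
        · exact mem_union_left _ (mem_sdiff.2 ⟨hy, hyS⟩)
      have := ha u huA
      simp only [hN] at h4 hu' this ⊢
      omega
    have h5 := sum_le_sum h3
    rw [sum_const, smul_eq_mul, sum_add_distrib, sum_const, smul_eq_mul] at h5
    have h6 := sum_card_bipartiteAbove_eq_sum_card_bipartiteBelow
      (s := L S) (t := S.biUnion N) (fun u y => G.Adj u y)
    simp only [bipartiteAbove, bipartiteBelow] at h6
    rw [h6] at h5
    have h7 : ∑ y ∈ S.biUnion N, #((L S).filter fun u => G.Adj u y) ≤
        ∑ _y ∈ S.biUnion N, b := by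
      refine sum_le_sum fun y hy => le_trans (card_le_card ?_) (hb y (hNB S hy))
      exact filter_subset_filter _ (hLA S)
    rw [sum_const, smul_eq_mul] at h7
    linarith
  have hsum : a * #(L S) + b * #(B \ S.biUnion N) ≤ b * #B + φ * #A := by
    have h8 := card_sdiff_add_card_eq_card (hNB S)
    have h9 : φ * #(L S) ≤ φ * #A := Nat.mul_le_mul_left _ (card_le_card (hLA S))
    rw [← h8, mul_add]
    omega
  have hmin : min #(L S) #(B \ S.biUnion N) ≤ t := by
    refine ht _ (le_trans ?_ hsum)
    rw [add_mul]
    exact add_le_add (Nat.mul_le_mul_left _ (min_le_left _ _))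
      (Nat.mul_le_mul_left _ (min_le_right _ _))
  rcases min_le_iff.1 hmin with h | h
  · exact h1.trans (Nat.pow_le_pow_right two_pos h)
  · exact h2.trans (Nat.pow_le_pow_right two_pos h)

theorem card_maxIndep_pos (G : SimpleGraph V) (F : Finset V) : 0 < #(maxIndep G F) := by
  obtain ⟨I, hI, -⟩ := exists_mem_maxIndep_superset (G := G) (empty_subset F) (by simp)
  exact card_pos.2 ⟨I, hI⟩

theorem logb_card_maxIndep_le {G : SimpleGraph V} {F : Finset V} {t : ℕ}
    (h : #(maxIndep G F) ≤ 2 ^ t) : Real.logb 2 #(maxIndep G F) ≤ t := by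
  rw [Real.logb_le_iff_le_rpow one_lt_two (by exact_mod_cast card_maxIndep_pos G F),
    Real.rpow_natCast]
  exact_mod_cast h

theorem le_logb_card_maxIndep {G : SimpleGraph V} {F : Finset V} {t : ℕ}
    (h : 2 ^ t ≤ #(maxIndep G F)) : (t : ℝ) ≤ Real.logb 2 #(maxIndep G F) := by
  rw [Real.le_logb_iff_rpow_le one_lt_two (by exact_mod_cast card_maxIndep_pos G F),
    Real.rpow_natCast]
  exact_mod_cast h

open Classical in
theorem logb_card_maxIndep_bipartite_le [DecidableEq V] {G : SimpleGraph V} {A B : Finset V}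
    (hA : ∀ x ∈ A, ∀ y ∈ A, ¬ G.Adj x y) (hB : ∀ x ∈ B, ∀ y ∈ B, ¬ G.Adj x y) {a b φ n : ℕ}
    (hφ : 0 < φ) (hab : 0 < a + b) (ha : ∀ u ∈ A, a ≤ #(B.filter fun y => G.Adj u y))
    (hb : ∀ y ∈ B, #(A.filter fun u => G.Adj u y) ≤ b) (hn : 1 ≤ n) :
    Real.logb 2 #(maxIndep G (A ∪ B)) ≤ 2 * #A / n + (#B / φ : ℝ) * Real.logb 2 n +
      (b * #B + φ * #A : ℝ) / (a + b) := by
  have h1 := card_maxIndep_bipartite_le hA hB hφ ha hb (t := (b * #B + φ * #A) / (a + b))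
    fun r hr => by rwa [Nat.le_div_iff_mul_le hab, mul_comm]
  have h2 := logb_card_small_subsets_le A (m := #B / φ) Nat.cast_div_le hn
  have h3 : (((b * #B + φ * #A) / (a + b) : ℕ) : ℝ) ≤ (b * #B + φ * #A : ℝ) / (a + b) := by
    refine Nat.cast_div_le.trans_eq ?_
    push_cast
    rfl
  have h4 : (0 : ℝ) < #(A.powerset.filter fun S => #S ≤ #B / φ) := by
    exact_mod_cast card_pos.2 ⟨∅, by simp⟩
  calc Real.logb 2 #(maxIndep G (A ∪ B))
      ≤ Real.logb 2 (#(A.powerset.filter fun S => #S ≤ #B / φ) *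
          2 ^ ((b * #B + φ * #A) / (a + b))) := by
        refine Real.logb_le_logb_of_le one_lt_two ?_ (by exact_mod_cast h1)
        exact_mod_cast card_maxIndep_pos G _
    _ = Real.logb 2 #(A.powerset.filter fun S => #S ≤ #B / φ) +
          ((b * #B + φ * #A) / (a + b) : ℕ) := by
        rw [Real.logb_mul h4.ne' (by positivity), Real.logb_pow, Real.logb_self_eq_one one_lt_two,
          mul_one]
    _ ≤ _ := add_le_add h2 h3

end Bipartite

/-! ### The cube and its pairs of consecutive levels -/

section Cube

variable {n : ℕ}

/-- The support of a binary string. -/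
def boolSupport (x : Fin n → Bool) : Finset (Fin n) :=
  univ.filter fun i => x i = true

theorem mem_boolSupport {x : Fin n → Bool} {i : Fin n} : i ∈ boolSupport x ↔ x i = true := by
  simp [boolSupport]

theorem boolSupport_injective : Function.Injective (boolSupport (n := n)) := by
  intro x y h
  funext i
  rw [Bool.eq_iff_iff, ← mem_boolSupport, ← mem_boolSupport, h]

theorem boolSupport_surjective : Function.Surjective (boolSupport (n := n)) := by
  intro s
  refine ⟨fun i => decide (i ∈ s), ?_⟩
  ext i
  simp [mem_boolSupport]

theorem hasse_adj_iff_symmDiff {s t : Finset (Fin n)} :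
    (SimpleGraph.hasse (Finset (Fin n))).Adj s t ↔ ∃ i, symmDiff s {i} = t := by
  rw [SimpleGraph.hasse_adj, Finset.covBy_iff_exists_insert, Finset.covBy_iff_exists_insert]
  constructor
  · rintro (⟨i, hi, rfl⟩ | ⟨i, hi, rfl⟩) <;> refine ⟨i, ?_⟩ <;> ext j <;>
    by_cases hj : j = i <;> simp [mem_symmDiff, hj, hi]
  · rintro ⟨i, rfl⟩
    by_cases hi : i ∈ s
    · right
      refine ⟨i, by simp [mem_symmDiff, hi], ?_⟩
      ext j
      by_cases hj : j = i <;> simp [mem_symmDiff, hj, hi]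
    · left
      refine ⟨i, hi, ?_⟩
      ext j
      by_cases hj : j = i <;> simp [mem_symmDiff, hj, hi]

theorem hasse_adj_boolSupport (x y : Fin n → Bool) :
    (SimpleGraph.hasse (Finset (Fin n))).Adj (boolSupport x) (boolSupport y) ↔
      (cubeGraph n).Adj x y := by
  rw [hasse_adj_iff_symmDiff]
  change _ ↔ hammingDist x y = 1
  rw [hammingDist, card_eq_one]
  refine exists_congr fun i => ?_
  rw [Finset.ext_iff, Finset.ext_iff]
  refine forall_congr' fun j => ?_
  simp only [mem_symmDiff, mem_boolSupport, mem_singleton, mem_filter, mem_univ, true_and]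
  by_cases hj : j = i <;> cases x j <;> cases y j <;> simp [hj]

theorem card_of_hasse_adj {s t : Finset (Fin n)}
    (h : (SimpleGraph.hasse (Finset (Fin n))).Adj s t) : #s + 1 = #t ∨ #t + 1 = #s := by
  rw [SimpleGraph.hasse_adj] at h
  rcases h with h | h
  · exact Or.inl (Nat.covBy_iff_add_one_eq.1 h.card_finset)
  · exact Or.inr (Nat.covBy_iff_add_one_eq.1 h.card_finset)

theorem mis_cubeGraph (n : ℕ) :
    mis (cubeGraph n) = #(maxIndep (SimpleGraph.hasse (Finset (Fin n))) univ) :=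
  mis_eq_card_maxIndep _ _ boolSupport boolSupport_injective hasse_adj_boolSupport _
    fun w => ⟨fun _ => boolSupport_surjective w, fun _ => mem_univ _⟩

theorem mis_cubeLevels (n k : ℕ) :
    mis (cubeLevels n k) = #(maxIndep (SimpleGraph.hasse (Finset (Fin n)))
      (powersetCard k univ ∪ powersetCard (k + 1) univ)) := by
  refine mis_eq_card_maxIndep _ _
    (fun x : {x : Fin n → Bool | weight x = k ∨ weight x = k + 1} => boolSupport x.1)
    (boolSupport_injective.comp Subtype.val_injective)
    (fun x y => hasse_adj_boolSupport x.1 y.1) _ fun w => ?_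
  simp only [mem_union, mem_powersetCard_univ]
  constructor
  · intro h
    obtain ⟨x, rfl⟩ := boolSupport_surjective w
    exact ⟨⟨x, h⟩, rfl⟩
  · rintro ⟨x, rfl⟩
    exact x.2

open Classical in
theorem card_hasse_up (s : Finset (Fin n)) :
    #((powersetCard (#s + 1) univ).filter fun t =>
      (SimpleGraph.hasse (Finset (Fin n))).Adj s t) = n - #s := by
  have h : ((powersetCard (#s + 1) univ).filter fun t =>
      (SimpleGraph.hasse (Finset (Fin n))).Adj s t) = sᶜ.image fun i => insert i s := by
    ext t
    simp only [mem_filter, mem_powersetCard_univ, mem_image, mem_compl, SimpleGraph.hasse_adj,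
      Finset.covBy_iff_exists_insert]
    constructor
    · rintro ⟨ht, h | ⟨i, hi, rfl⟩⟩
      · exact h
      · rw [card_insert_of_notMem hi] at ht
        omega
    · rintro ⟨i, hi, rfl⟩
      exact ⟨card_insert_of_notMem hi, Or.inl ⟨i, hi, rfl⟩⟩
  rw [h, card_image_of_injOn, card_compl, Fintype.card_fin]
  intro i hi j hj hij
  have hi' : i ∉ s := by simpa using hi
  have : i ∈ insert j s := by
    have := mem_insert_self i s
    simp only at hij
    rwa [hij] at this
  exact (mem_insert.1 this).resolve_right hi'

open Classical in
theorem card_hasse_down_le (t : Finset (Fin n)) (k : ℕ) (ht : #t = k + 1) :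
    #((powersetCard k univ).filter fun s =>
      (SimpleGraph.hasse (Finset (Fin n))).Adj s t) ≤ k + 1 := by
  have h : ((powersetCard k univ).filter fun s =>
      (SimpleGraph.hasse (Finset (Fin n))).Adj s t) ⊆ t.image fun i => t.erase i := by
    intro s
    simp only [mem_filter, mem_powersetCard_univ, mem_image, SimpleGraph.hasse_adj,
      Finset.covBy_iff_exists_insert]
    rintro ⟨hs, ⟨i, hi, rfl⟩ | ⟨i, hi, rfl⟩⟩
    · exact ⟨i, mem_insert_self _ _, erase_insert hi⟩
    · rw [card_insert_of_notMem hi] at hs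
      omega
  exact (card_le_card h).trans (card_image_le.trans ht.le)

open Classical in
theorem card_hasse_neighbors (s : Finset (Fin n)) :
    #(univ.filter fun t => (SimpleGraph.hasse (Finset (Fin n))).Adj s t) = n := by
  have h : (univ.filter fun t => (SimpleGraph.hasse (Finset (Fin n))).Adj s t) =
      univ.image fun i => symmDiff s {i} := by
    ext t
    simp only [mem_filter, mem_univ, true_and, mem_image]
    exact hasse_adj_iff_symmDiff
  rw [h, card_image_of_injective, card_univ, Fintype.card_fin]
  intro i j hij
  exact singleton_injective (symmDiff_right_injective s hij)

/-- Erasing `a` is a bijection onto the subsets of `U`; the inverse restores `a` exactly when parity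
requires it. -/
theorem card_even_subsets {α : Type*} [DecidableEq α] {U : Finset α} {a : α} (ha : a ∉ U) :
    #((insert a U).powerset.filter fun s => Even #s) = 2 ^ #U := by
  rw [← card_powerset]
  refine card_nbij' (fun s => s.erase a) (fun T => if Even #T then T else insert a T) ?_ ?_ ?_ ?_
  · intro s hs
    simp only [coe_filter, mem_powerset, Set.mem_ofPred_eq] at hs
    exact mem_coe.2 (mem_powerset.2 (subset_insert_iff.1 hs.1))
  · intro T hT
    have hT' : T ⊆ U := by simpa using hT
    have haT : a ∉ T := fun h => ha (hT' h)
    simp only [coe_filter, mem_powerset, Set.mem_ofPred_eq]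
    split_ifs with h
    · exact ⟨hT'.trans (subset_insert _ _), h⟩
    · refine ⟨insert_subset_insert _ hT', ?_⟩
      rw [card_insert_of_notMem haT]
      exact (Nat.not_even_iff_odd.1 h).add_one
  · intro s hs
    simp only [coe_filter, mem_powerset, Set.mem_ofPred_eq] at hs
    by_cases has : a ∈ s
    · have h1 := card_erase_add_one has
      have h2 : ¬ Even #(s.erase a) := fun h => by
        have := h.add_one
        rw [h1] at this
        exact (Nat.not_even_iff_odd.2 this) hs.2
      simp [h2, insert_erase has]
    · simp [erase_eq_of_notMem has, hs.2]
  · intro T hT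
    have hT' : T ⊆ U := by simpa using hT
    have haT : a ∉ T := fun h => ha (hT' h)
    simp only
    split_ifs with h
    · exact erase_eq_of_notMem haT
    · exact erase_insert haT

theorem hasse_adj_insert_iff {s t : Finset (Fin n)} {a : Fin n} (hs : a ∉ s) (ht : a ∉ t) :
    (SimpleGraph.hasse (Finset (Fin n))).Adj s (insert a t) ↔ s = t := by
  rw [SimpleGraph.hasse_adj]
  constructor
  · rintro (h | h)
    · obtain ⟨i, hi, h⟩ := Finset.covBy_iff_exists_insert.1 h
      have hai : a ∈ insert i s := h ▸ mem_insert_self a t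
      obtain rfl : a = i := (mem_insert.1 hai).resolve_right hs
      rw [← erase_insert hs, h, erase_insert ht]
    · exact absurd (h.le (mem_insert_self a t)) hs
  · rintro rfl
    exact Or.inl (Finset.covBy_insert hs)

/-- The matching runs in direction 0 over the even subsets of the other coordinates; parity excludes
edges between two lower ends or two upper ends. -/
theorem two_pow_le_mis_cubeGraph (n : ℕ) : 2 ^ 2 ^ n ≤ mis (cubeGraph (n + 2)) := by
  rw [mis_cubeGraph]
  set U : Finset (Fin (n + 2)) := univ.erase 0 with hU
  have h1 : (1 : Fin (n + 2)) ∈ U := by simp [hU]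
  have hcard : #(U.powerset.filter fun s => Even #s) = 2 ^ n := by
    have := card_even_subsets (notMem_erase (1 : Fin (n + 2)) U)
    rw [insert_erase h1] at this
    rw [this, card_erase_of_mem h1, card_erase_of_mem (mem_univ _)]
    simp
  have h0 : ∀ s ∈ U.powerset.filter fun s => Even #s, (0 : Fin (n + 2)) ∉ s := by
    intro s hs h
    simpa [hU] using mem_powerset.1 (mem_filter.1 hs).1 h
  have hpar : ∀ s t : Finset (Fin (n + 2)), (Even #s ↔ Even #t) →
      ¬ (SimpleGraph.hasse (Finset (Fin (n + 2)))).Adj s t := by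
    intro s t h hst
    rcases card_of_hasse_adj hst with h' | h' <;>
      (rw [← h', Nat.even_add_one] at h; tauto)
  rw [← hcard]
  refine two_pow_le_card_maxIndep _ id (insert 0) (by simp) (by simp) ?_ ?_ ?_
  · intro s hs t ht
    exact hasse_adj_insert_iff (h0 s hs) (h0 t ht)
  · intro s hs t ht
    exact hpar _ _ (iff_of_true (mem_filter.1 hs).2 (mem_filter.1 ht).2)
  · intro s hs t ht
    refine hpar _ _ ?_
    rw [card_insert_of_notMem (h0 s hs), card_insert_of_notMem (h0 t ht), Nat.even_add_one,
      Nat.even_add_one]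
    exact iff_of_false (not_not.2 (mem_filter.1 hs).2) (not_not.2 (mem_filter.1 ht).2)

theorem two_pow_le_mis_cubeLevels (n k : ℕ) :
    2 ^ (n.choose k) ≤ mis (cubeLevels (n + 1) k) := by
  rw [mis_cubeLevels]
  have hcard : #(powersetCard k ((univ : Finset (Fin (n + 1))).erase 0)) = n.choose k := by
    rw [card_powersetCard, card_erase_of_mem (mem_univ _)]
    simp
  have h0 : ∀ s ∈ powersetCard k ((univ : Finset (Fin (n + 1))).erase 0), 0 ∉ s := by
    intro s hs h
    simpa using (mem_powersetCard.1 hs).1 h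
  have hlev : ∀ s t : Finset (Fin (n + 1)), #s = #t →
      ¬ (SimpleGraph.hasse (Finset (Fin (n + 1)))).Adj s t := by
    intro s t h hst
    have := card_of_hasse_adj hst
    omega
  have hc : ∀ s ∈ powersetCard k ((univ : Finset (Fin (n + 1))).erase 0),
      #(insert 0 s) = k + 1 := by
    intro s hs
    rw [card_insert_of_notMem (h0 s hs), (mem_powersetCard.1 hs).2]
  rw [← hcard]
  refine two_pow_le_card_maxIndep _ id (insert 0) ?_ ?_ ?_ ?_ ?_
  · intro s hs
    simp [(mem_powersetCard.1 hs).2]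
  · intro s hs
    simp [hc s hs]
  · intro s hs t ht
    exact hasse_adj_insert_iff (h0 s hs) (h0 t ht)
  · intro s hs t ht
    exact hlev _ _ ((mem_powersetCard.1 hs).2.trans (mem_powersetCard.1 ht).2.symm)
  · intro s hs t ht
    exact hlev _ _ ((hc s hs).trans (hc t ht).symm)

/-- The sides are the even and the odd sets, and every degree is n, so a = b = n. -/
theorem logb_mis_cubeGraph_le {n φ : ℕ} (hn : 1 ≤ n) (hφ : 0 < φ) :
    Real.logb 2 (mis (cubeGraph n)) ≤
      2 * 2 ^ (n - 1) / n + (2 ^ (n - 1) / φ : ℝ) * Real.logb 2 n +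
        (n * 2 ^ (n - 1) + φ * 2 ^ (n - 1) : ℝ) / (n + n) := by
  classical
  set A : Finset (Finset (Fin n)) := univ.filter fun s => Even #s with hA
  set B : Finset (Finset (Fin n)) := univ.filter fun s => ¬ Even #s with hB
  have hAB : (univ : Finset (Finset (Fin n))) = A ∪ B := by
    rw [hA, hB, filter_union_filter_not_eq]
  obtain ⟨m, rfl⟩ : ∃ m, n = m + 1 := ⟨n - 1, by omega⟩
  have hcA : #A = 2 ^ m := by
    have := card_even_subsets (notMem_erase (0 : Fin (m + 1)) univ)
    rw [insert_erase (mem_univ _), powerset_univ, card_erase_of_mem (mem_univ _)] at this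
    simpa using this
  have hcB : #B = 2 ^ m := by
    have h1 := card_filter_add_card_filter_not (s := (univ : Finset (Finset (Fin (m + 1)))))
      (fun s => Even #s)
    rw [card_univ, Fintype.card_finset, Fintype.card_fin, pow_succ] at h1
    simp only [hA] at hcA
    simp only [hB]
    omega
  have hpar : ∀ s t : Finset (Fin (m + 1)),
      (SimpleGraph.hasse (Finset (Fin (m + 1)))).Adj s t → (Even #s ↔ ¬ Even #t) := by
    intro s t hst
    rcases card_of_hasse_adj hst with h' | h'
    · rw [← h', Nat.even_add_one, not_not]
    · rw [← h', Nat.even_add_one]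
  have hmain := logb_card_maxIndep_bipartite_le
    (G := SimpleGraph.hasse (Finset (Fin (m + 1)))) (A := A) (B := B)
    (a := m + 1) (b := m + 1) (φ := φ) (n := m + 1) ?_ ?_ hφ (by omega) ?_ ?_ hn
  · rw [mis_cubeGraph, hAB]
    rw [hcA, hcB] at hmain
    simpa using hmain
  · intro s hs t ht hst
    exact (hpar s t hst).1 (mem_filter.1 hs).2 (mem_filter.1 ht).2
  · intro s hs t ht hst
    exact (mem_filter.1 hs).2 ((hpar s t hst).2 (mem_filter.1 ht).2)
  · intro u hu
    refine (card_hasse_neighbors u).symm.le.trans (card_le_card fun t ht => ?_)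
    have ht' := (mem_filter.1 ht).2
    exact mem_filter.2 ⟨mem_filter.2 ⟨mem_univ _, (hpar u t ht').1 (mem_filter.1 hu).2⟩, ht'⟩
  · intro y hy
    refine le_trans (card_le_card fun t ht => ?_) (card_hasse_neighbors y).le
    exact mem_filter.2 ⟨mem_univ _, (mem_filter.1 ht).2.symm⟩

theorem logb_mis_cubeLevels_le {n k φ : ℕ} (hn : 1 ≤ n) (hφ : 0 < φ) :
    Real.logb 2 (mis (cubeLevels n k)) ≤
      2 * n.choose k / n + (n.choose (k + 1) / φ : ℝ) * Real.logb 2 n +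
        ((k + 1 : ℕ) * n.choose (k + 1) + φ * n.choose k : ℝ) / ((n - k : ℕ) + (k + 1 : ℕ)) := by
  classical
  have hmain := logb_card_maxIndep_bipartite_le
    (G := SimpleGraph.hasse (Finset (Fin n))) (A := powersetCard k univ)
    (B := powersetCard (k + 1) univ)
    (a := n - k) (b := k + 1) (φ := φ) (n := n) ?_ ?_ hφ (by omega) ?_ ?_ hn
  · rw [mis_cubeLevels]
    simpa using hmain
  · intro s hs t ht hst
    rw [mem_powersetCard_univ] at hs ht
    have := card_of_hasse_adj hst
    omega
  · intro s hs t ht hst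
    rw [mem_powersetCard_univ] at hs ht
    have := card_of_hasse_adj hst
    omega
  · intro u hu
    rw [mem_powersetCard_univ] at hu
    have := card_hasse_up u
    rw [hu] at this
    exact this.symm.le
  · intro y hy
    exact card_hasse_down_le y k (mem_powersetCard_univ.1 hy)

/-- The trace on either level determines the set. This crude bound is sharp enough when k is near 0
or n, where the container bound is not used. -/
theorem logb_mis_cubeLevels_le_choose (n k : ℕ) :
    Real.logb 2 (mis (cubeLevels n k)) ≤ n.choose k ∧
      Real.logb 2 (mis (cubeLevels n k)) ≤ n.choose (k + 1) := by
  rw [mis_cubeLevels]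
  have hlev : ∀ s t : Finset (Fin n), #s = #t →
      ¬ (SimpleGraph.hasse (Finset (Fin n))).Adj s t := by
    intro s t h hst
    have := card_of_hasse_adj hst
    omega
  constructor
  · refine logb_card_maxIndep_le ((card_maxIndep_le_two_pow (A := powersetCard k univ) ?_).trans_eq
      (by simp))
    intro x hx hxA y hy hyA
    simp only [mem_union, mem_powersetCard_univ] at hx hxA hy hyA
    exact hlev x y (by omega)
  · refine logb_card_maxIndep_le
      ((card_maxIndep_le_two_pow (A := powersetCard (k + 1) univ) ?_).trans_eq (by simp))
    intro x hx hxA y hy hyA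
    simp only [mem_union, mem_powersetCard_univ] at hx hxA hy hyA
    exact hlev x y (by omega)

end Cube

/-! ### Convex families: counting maximal antichains and bounding size -/

section Antichains

/-- The comparability graph of a partial order. -/
def comparabilityGraph (P : Type*) [PartialOrder P] : SimpleGraph P where
  Adj x y := x < y ∨ y < x
  symm := ⟨fun _ _ h => h.symm⟩
  loopless := ⟨fun _ h => h.elim (lt_irrefl _) (lt_irrefl _)⟩

theorem comparabilityGraph_adj {P : Type*} [PartialOrder P] {x y : P} :
    (comparabilityGraph P).Adj x y ↔ x < y ∨ y < x := Iff.rfl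

theorem numMaxAntichains_eq_mis (P : Type*) [PartialOrder P] :
    numMaxAntichains P = mis (comparabilityGraph P) := by
  have key : ∀ s : Set P, IsAntichain (· ≤ ·) s ↔ (comparabilityGraph P).IsIndepSet s := by
    intro s
    constructor
    · rintro h x hx y hy hne (hlt | hlt)
      · exact h hx hy hne hlt.le
      · exact h hy hx hne.symm hlt.le
    · intro h x hx y hy hne hle
      exact h hx hy hne (Or.inl (lt_of_le_of_ne hle hne))
  rw [numMaxAntichains, mis]
  congr 1
  ext s
  simp only [Set.mem_ofPred_eq]
  constructor
  · intro h
    refine ⟨(key s).1 h.1, fun t ht hst => ?_⟩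
    exact (h.2 ((key t).2 ht) hst).ge
  · intro h
    refine ⟨(key s).2 h.prop, fun t ht hst => ?_⟩
    exact Set.Subset.antisymm hst (h.le_of_ge ((key t).1 ht) hst)

theorem mis_eq_card_maxIndep_univ {V : Type*} [Fintype V] (G : SimpleGraph V) :
    mis G = #(maxIndep G univ) :=
  mis_eq_card_maxIndep G G id Function.injective_id (fun _ _ => Iff.rfl) univ (by simp)

/-- If I contains `x`, removing `x` leaves a set maximal away from `x` and its neighbours; otherwise
I stays maximal in `F.erase x`. -/
theorem card_maxIndep_le_add {V : Type*} [DecidableEq V] {G : SimpleGraph V} {F D : Finset V}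
    {x : V} (hx : x ∈ F) (hD : ∀ y, y ∈ D ↔ y ∈ F ∧ G.Adj x y) :
    #(maxIndep G F) ≤ #(maxIndep G (F \ insert x D)) + #(maxIndep G (F.erase x)) := by
  have hsub : maxIndep G F ⊆
      (maxIndep G (F \ insert x D)).image (insert x) ∪ maxIndep G (F.erase x) := by
    intro I hI
    obtain ⟨hIF, hind, hmax⟩ := mem_maxIndep.1 hI
    by_cases hxI : x ∈ I
    · refine mem_union_left _ (mem_image.2 ⟨I.erase x, mem_maxIndep.2 ⟨?_, ?_, ?_⟩,
        insert_erase hxI⟩)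
      · intro y hy
        obtain ⟨hyx, hyI⟩ := mem_erase.1 hy
        rw [Finset.mem_sdiff, mem_insert, hD]
        refine ⟨hIF hyI, ?_⟩
        rintro (rfl | h)
        · exact hyx rfl
        · exact hind x hxI y hyI h.2
      · exact fun u hu v hv => hind u (mem_of_mem_erase hu) v (mem_of_mem_erase hv)
      · intro u hu huI
        rw [Finset.mem_sdiff, mem_insert, hD, not_or] at hu
        obtain ⟨v, hv, huv⟩ := hmax u hu.1 fun h => huI (mem_erase.2 ⟨hu.2.1, h⟩)
        refine ⟨v, mem_erase.2 ⟨?_, hv⟩, huv⟩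
        rintro rfl
        exact hu.2.2 ⟨hu.1, huv.symm⟩
    · refine mem_union_right _ (maxIndep_restrict hI (erase_subset _ _) fun y hy => ?_)
      exact mem_erase.2 ⟨fun h => hxI (h ▸ hy), hIF hy⟩
  exact (card_le_card hsub).trans ((card_union_le _ _).trans
    (Nat.add_le_add_right card_image_le _))

/-- The minimal elements form an antichain, and so do the others, because a comparable pair of
non-minimal elements would extend downwards to a three-chain. The trace on either part determines
the antichain. -/
theorem card_maxIndep_sq_le_of_no_chain {P : Type*} [PartialOrder P] {F : Finset P}
    (h : ∀ x ∈ F, ∀ y ∈ F, ∀ z ∈ F, x < y → y < z → False) :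
    #(maxIndep (comparabilityGraph P) F) ^ 2 ≤ 2 ^ #F := by
  classical
  set A := F.filter fun x => ∀ y ∈ F, ¬ y < x with hA
  have hnot : ∀ x ∈ F, x ∉ A → ∃ y ∈ F, y < x := by
    intro x hx hxA
    by_contra! hcon
    exact hxA (mem_filter.2 ⟨hx, hcon⟩)
  have h1 : #(maxIndep (comparabilityGraph P) F) ≤ 2 ^ #A := by
    refine card_maxIndep_le_two_pow ?_
    rintro x hx hxA y hy hyA (hxy | hxy)
    · obtain ⟨w, hw, hwx⟩ := hnot x hx hxA
      exact h w hw x hx y hy hwx hxy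
    · obtain ⟨w, hw, hwy⟩ := hnot y hy hyA
      exact h w hw y hy x hx hwy hxy
  have h2 : #(maxIndep (comparabilityGraph P) F) ≤ 2 ^ #(F \ A) := by
    refine card_maxIndep_le_two_pow ?_
    intro x hx hxA y hy hyA hxy
    have hx' : x ∈ A := by simpa [hx] using hxA
    have hy' : y ∈ A := by simpa [hy] using hyA
    rcases hxy with hxy | hxy
    · exact (mem_filter.1 hy').2 x hx hxy
    · exact (mem_filter.1 hx').2 y hy hxy
  have h3 := card_sdiff_add_card_eq_card (filter_subset (fun x => ∀ y ∈ F, ¬ y < x) F)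
  rw [← hA] at h3
  calc _ = #(maxIndep (comparabilityGraph P) F) * #(maxIndep (comparabilityGraph P) F) := sq _
    _ ≤ 2 ^ #(F \ A) * 2 ^ #A := Nat.mul_le_mul h2 h1
    _ = 2 ^ #F := by rw [← pow_add, h3]

/-- A convex family of sets `F` has at most `2 ^ (#F / 2)` maximal antichains. -/
theorem card_maxIndep_sq_le_of_ordConnected {α : Type*} [DecidableEq α] (F : Finset (Finset α))
    (hF : (F : Set (Finset α)).OrdConnected) :
    #(maxIndep (comparabilityGraph (Finset α)) F) ^ 2 ≤ 2 ^ #F := by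
  classical
  induction hf : #F using Nat.strong_induction_on generalizing F with
  | _ f ih =>
  subst hf
  by_cases hchain : ∀ x ∈ F, ∀ y ∈ F, ∀ z ∈ F, x < y → y < z → False
  · exact card_maxIndep_sq_le_of_no_chain hchain
  push Not at hchain
  obtain ⟨x₁, hx₁, y, hy, z, hz, hxy₁, hyz, -⟩ := hchain
  obtain ⟨x, hxx₁, hxmin⟩ := F.exists_le_minimal hx₁
  have hxF : x ∈ F := hxmin.prop
  have hxy : x < y := lt_of_le_of_lt hxx₁ hxy₁
  set D := F.filter fun u => (comparabilityGraph (Finset α)).Adj x u with hD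
  have hmemD : ∀ u, u ∈ D ↔ u ∈ F ∧ (comparabilityGraph (Finset α)).Adj x u := by simp [hD]
  -- Two elements above x would not suffice for the recursion, as 2^(-3/2) + 2^(-1/2) > 1. Convexity
  -- supplies a third, w = x ∪ (z \ y), which differs from y and z.
  have hD3 : 3 ≤ #D := by
    obtain ⟨i, hiz, hiy⟩ := Finset.exists_of_ssubset hyz
    obtain ⟨j, hjy, hjx⟩ := Finset.exists_of_ssubset hxy
    set w := x ∪ (z \ y) with hw
    have hiw : i ∈ w := mem_union_right _ (mem_sdiff.2 ⟨hiz, hiy⟩)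
    have hjw : j ∉ w := by simp [hw, hjx, hjy]
    have hix : i ∉ x := fun h => hiy (hxy.le h)
    have hxw : x < w := ⟨subset_union_left, fun h => hix (h hiw)⟩
    have hwz : w ≤ z := union_subset (hxy.le.trans hyz.le) sdiff_subset
    have hwy : w ≠ y := fun h => hiy (h ▸ hiw)
    have hwz' : w ≠ z := fun h => hjw (h ▸ hyz.le hjy)
    have hsub : {w, y, z} ⊆ D := by
      intro u hu
      rw [hmemD]
      simp only [mem_insert, mem_singleton] at hu
      rcases hu with rfl | rfl | rfl
      · exact ⟨hF.out hxF hz ⟨hxw.le, hwz⟩, Or.inl hxw⟩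
      · exact ⟨hy, Or.inl hxy⟩
      · exact ⟨hz, Or.inl (hxy.trans hyz)⟩
    refine le_trans ?_ (card_le_card hsub)
    rw [card_insert_of_notMem (by simp [hwy, hwz']), card_pair hyz.ne]
  have hxD : x ∉ D := fun h => ((hmemD x).1 h).2.ne rfl
  have hsub : insert x D ⊆ F := insert_subset hxF (filter_subset _ _)
  have hc1 : #(F \ insert x D) + (#D + 1) = #F := by
    rw [← card_insert_of_notMem hxD, card_sdiff_add_card_eq_card hsub]
  have hc2 : #(F.erase x) + 1 = #F := card_erase_add_one hxF
  have hi1 := ih _ (by omega) (F \ insert x D) ?_ rfl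
  · have hi2 := ih _ (by omega) (F.erase x) ?_ rfl
    · have hadd := card_maxIndep_le_add hxF hmemD
      set m := #(maxIndep (comparabilityGraph (Finset α)) F)
      set m₁ := #(maxIndep (comparabilityGraph (Finset α)) (F \ insert x D))
      set m₂ := #(maxIndep (comparabilityGraph (Finset α)) (F.erase x))
      obtain ⟨r, hr⟩ : ∃ r, #F = r + 4 := ⟨#F - 4, by omega⟩
      have e1 : m₁ ^ 2 ≤ 2 ^ r := hi1.trans (Nat.pow_le_pow_right two_pos (by omega))
      have e2 : m₂ ^ 2 ≤ 8 * 2 ^ r := by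
        refine hi2.trans_eq ?_
        rw [show #(F.erase x) = r + 3 by omega, pow_add]
        ring
      rw [hr, pow_add]
      have e3 : m ^ 2 ≤ (m₁ + m₂) ^ 2 := Nat.pow_le_pow_left hadd 2
      zify at e1 e2 e3 ⊢
      -- The square gives (m₁ + m₂)² ≤ 4 m₁² + (4/3) m₂² ≤ (4 + 32/3) 2^r, which is below 16 · 2^r.
      nlinarith [sq_nonneg (3 * (m₁ : ℤ) - m₂)]
    · refine ⟨fun u hu v hv w hw => ?_⟩
      rw [mem_coe, mem_erase] at hu hv ⊢
      refine ⟨?_, hF.out hu.2 hv.2 hw⟩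
      rintro rfl
      exact hu.1 (le_antisymm hw.1 (hxmin.le_of_le hu.2 hw.1))
  · refine ⟨fun u hu v hv w hw => ?_⟩
    rw [mem_coe, Finset.mem_sdiff, mem_insert, not_or, hmemD] at hu hv ⊢
    have hle : ∀ u, u ∈ F → u ≠ x ∧ ¬ (u ∈ F ∧ (comparabilityGraph (Finset α)).Adj x u) →
        ¬ x ≤ u ∧ ¬ u ≤ x := by
      intro u huF hu
      refine ⟨fun h => hu.2 ⟨huF, Or.inl (lt_of_le_of_ne h hu.1.symm)⟩,
        fun h => hu.2 ⟨huF, Or.inr (lt_of_le_of_ne h hu.1)⟩⟩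
    refine ⟨hF.out hu.1 hv.1 hw, ?_, ?_⟩
    · rintro rfl
      exact (hle u hu.1 hu.2).2 hw.1
    · rintro ⟨-, h | h⟩
      · exact (hle v hv.1 hv.2).1 (h.le.trans hw.2)
      · exact (hle u hu.1 hu.2).2 (hw.1.trans h.le)

variable {n : ℕ}

/-- Counting the pairs of a set of size `k` and a set of size `k + 1` covering it at the upper
boundary of a convex family. -/
theorem card_boundary_level {X E : Finset (Finset (Fin n))} {φ k : ℕ}
    (hE : ∀ z, z ∈ E ↔ z ∉ X ∧ ∃ x ∈ X, x < z) (hX : (X : Set (Finset (Fin n))).OrdConnected)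
    (hdeg : ∀ x ∈ X, #(X.filter fun y => x < y) ≤ φ) :
    (n - k) * #(E.filter fun s => #s = k) + (n - k - φ) * #(X.filter fun s => #s = k) ≤
      (k + 1) * #(E.filter fun s => #s = k + 1) := by
  classical
  set r : Finset (Fin n) → Finset (Fin n) → Prop :=
    fun s t => (SimpleGraph.hasse (Finset (Fin n))).Adj s t with hr
  set E₀ := E.filter fun s => #s = k
  set X₀ := X.filter fun s => #s = k
  set E₁ := E.filter fun s => #s = k + 1
  have hdisj : Disjoint E₀ X₀ := by
    rw [disjoint_left]
    intro z hz hz'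
    exact ((hE z).1 (mem_filter.1 hz).1).1 (mem_filter.1 hz').1
  have hcount := sum_card_bipartiteAbove_eq_sum_card_bipartiteBelow (s := E₀ ∪ X₀) (t := E₁) r
  simp only [bipartiteAbove, bipartiteBelow] at hcount
  have hup : ∑ t ∈ E₁, #((E₀ ∪ X₀).filter fun s => r s t) ≤ (k + 1) * #E₁ := by
    rw [mul_comm, ← smul_eq_mul]
    refine sum_le_card_nsmul _ _ _ fun t ht => ?_
    refine le_trans (card_le_card fun s hs => ?_) (card_hasse_down_le t k (mem_filter.1 ht).2)
    rw [mem_filter, mem_powersetCard_univ]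
    refine ⟨?_, (mem_filter.1 hs).2⟩
    rcases mem_union.1 (mem_filter.1 hs).1 with h | h <;> exact (mem_filter.1 h).2
  have hlt : ∀ s t : Finset (Fin n), #s = k → #t = k + 1 → r s t → s < t := by
    rintro s t hs ht (h | h)
    · exact h.lt
    · have := card_lt_card h.lt
      omega
  -- Every cover of a member of `E` is in `E`: were it in `X`, convexity would put the member itself
  -- in `X`.
  have hE₀ : (n - k) * #E₀ ≤ ∑ s ∈ E₀, #(E₁.filter fun t => r s t) := by
    rw [mul_comm, ← smul_eq_mul]
    refine card_nsmul_le_sum _ _ _ fun s hs => ?_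
    obtain ⟨hsE, hsk⟩ := mem_filter.1 hs
    have h1 := card_hasse_up s
    rw [hsk] at h1
    rw [← h1]
    refine card_le_card fun t ht => ?_
    rw [mem_filter, mem_powersetCard_univ] at ht
    have hst := hlt s t hsk ht.1 ht.2
    refine mem_filter.2 ⟨mem_filter.2 ⟨(hE t).2 ?_, ht.1⟩, ht.2⟩
    obtain ⟨hsX, x, hx, hxs⟩ := (hE s).1 hsE
    exact ⟨fun htX => hsX (hX.out hx htX ⟨hxs.le, hst.le⟩), x, hx, hxs.trans hst⟩
  have hX₀ : (n - k - φ) * #X₀ ≤ ∑ s ∈ X₀, #(E₁.filter fun t => r s t) := by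
    rw [mul_comm, ← smul_eq_mul]
    refine card_nsmul_le_sum _ _ _ fun s hs => ?_
    obtain ⟨hsX, hsk⟩ := mem_filter.1 hs
    have h1 := card_hasse_up s
    rw [hsk] at h1
    rw [Nat.sub_le_iff_le_add, ← h1]
    refine le_trans ?_ (Nat.add_le_add_left (hdeg s hsX) _)
    refine le_trans (card_le_card fun t ht => ?_)
      (card_union_le (E₁.filter fun t => r s t) (X.filter fun y => s < y))
    rw [mem_filter, mem_powersetCard_univ] at ht
    have hst := hlt s t hsk ht.1 ht.2
    by_cases htX : t ∈ X
    · exact mem_union_right _ (mem_filter.2 ⟨htX, hst⟩)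
    · exact mem_union_left _
        (mem_filter.2 ⟨mem_filter.2 ⟨(hE t).2 ⟨htX, s, hsX, hst⟩, ht.1⟩, ht.2⟩)
  calc _ ≤ _ := add_le_add hE₀ hX₀
    _ = ∑ s ∈ E₀ ∪ X₀, #(E₁.filter fun t => r s t) := (sum_union hdisj).symm
    _ ≤ _ := hcount.trans_le hup

/-- A convex family of sets in which every member has few members above it is not much larger
than the middle level. -/
theorem card_le_of_ordConnected {X : Finset (Finset (Fin n))} {φ : ℕ} {d : ℝ}
    (hX : (X : Set (Finset (Fin n))).OrdConnected)
    (hdeg : ∀ x ∈ X, #(X.filter fun y => x < y) ≤ φ) (hd : φ < d)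
    (hXd : ∀ x ∈ X, d ≤ n - #x) :
    (1 - φ / d) * #X ≤ n.choose (n / 2) := by
  classical
  set E : Finset (Finset (Fin n)) := univ.filter fun z => z ∉ X ∧ ∃ x ∈ X, x < z with hEdef
  have hE : ∀ z, z ∈ E ↔ z ∉ X ∧ ∃ x ∈ X, x < z := by simp [hEdef]
  have hd0 : 0 < d := lt_of_le_of_lt (Nat.cast_nonneg φ) hd
  have hφd : 0 ≤ 1 - φ / d := by
    rw [sub_nonneg, div_le_one hd0]
    exact hd.le
  -- `p k` is the density in level k of the sets outside `X` lying above a member of `X`. It is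
  -- nondecreasing and gains at least a share proportional to the part of `X` in level k; since it
  -- ends at most at 1, telescoping bounds `#X`.
  set p : ℕ → ℝ := fun k => #(E.filter fun s => #s = k) / n.choose k with hp
  set N : ℝ := ((n.choose (n / 2) : ℕ) : ℝ) with hN
  have hN0 : 0 < N := by
    rw [hN]
    exact_mod_cast Nat.choose_pos (Nat.div_le_self n 2)
  have hstep : ∀ k ∈ range n,
      (1 - φ / d) * #(X.filter fun s => #s = k) / N ≤ p (k + 1) - p k := by
    intro k hk
    have hkn : k < n := mem_range.1 hk
    have hck : (0 : ℝ) < n.choose k := by exact_mod_cast Nat.choose_pos hkn.le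
    have hck1 : (0 : ℝ) < n.choose (k + 1) := by exact_mod_cast Nat.choose_pos hkn
    have hnk : (0 : ℝ) < n - k := by
      rw [sub_pos]
      exact_mod_cast hkn
    have hlev : ((n : ℝ) - k) * #(E.filter fun s => #s = k) +
        (n - k - φ) * #(X.filter fun s => #s = k) ≤
        (k + 1) * #(E.filter fun s => #s = k + 1) := by
      have h1 := card_boundary_level (k := k) hE hX hdeg
      have h2 : ((n : ℝ) - k - φ) ≤ (n - k - φ : ℕ) := by
        rw [sub_sub, Nat.sub_sub]
        have : n ≤ (n - (k + φ)) + (k + φ) := le_tsub_add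
        have : (n : ℝ) ≤ ((n - (k + φ) : ℕ) : ℝ) + (k + φ) := by exact_mod_cast this
        linarith
      have h3 : (n : ℝ) - k = (n - k : ℕ) := by
        rw [Nat.cast_sub hkn.le]
      calc _ ≤ ((n - k : ℕ) : ℝ) * #(E.filter fun s => #s = k) +
            (n - k - φ : ℕ) * #(X.filter fun s => #s = k) := by
            rw [← h3]
            gcongr
        _ ≤ _ := by exact_mod_cast h1
    have hchoose : (n.choose (k + 1) : ℝ) * (k + 1) = n.choose k * (n - k) := by
      have h1 := Nat.choose_succ_right_eq n k
      rw [← Nat.cast_sub hkn.le]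
      exact_mod_cast h1
    have h4 : (1 - φ / d) * #(X.filter fun s => #s = k) / N ≤
        (n - k - φ) * #(X.filter fun s => #s = k) / (n.choose k * (n - k)) := by
      rcases (X.filter fun s => #s = k).eq_empty_or_nonempty with h0 | ⟨x, hx⟩
      · simp [h0]
      · have hdk : d ≤ n - k := by
          have := hXd x (mem_filter.1 hx).1
          rwa [(mem_filter.1 hx).2] at this
        have h5 : (1 - φ / d) ≤ (n - k - φ) / (n - k) := by
          rw [sub_div, div_self hnk.ne']
          gcongr
        have h6 : (n.choose k : ℝ) ≤ N := by
          rw [hN]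
          exact_mod_cast Nat.choose_le_middle k n
        calc (1 - φ / d) * #(X.filter fun s => #s = k) / N
            ≤ (1 - φ / d) * #(X.filter fun s => #s = k) / n.choose k := by gcongr
          _ ≤ ((n - k - φ) / (n - k)) * #(X.filter fun s => #s = k) / n.choose k := by gcongr
          _ = _ := by
            field_simp
    refine h4.trans ?_
    have h7 : p (k + 1) = (k + 1) * #(E.filter fun s => #s = k + 1) /
        (n.choose k * (n - k)) := by
      rw [← hchoose, hp]
      field_simp
    have h8 : p k = (n - k) * #(E.filter fun s => #s = k) / (n.choose k * (n - k)) := by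
      rw [hp]
      field_simp
    rw [h7, h8, ← sub_div]
    gcongr
    linarith
  have hsum := sum_le_sum hstep
  rw [sum_range_sub] at hsum
  have hfiber : (#X : ℝ) = ∑ k ∈ range n, (#(X.filter fun s => #s = k) : ℝ) := by
    rw [← Nat.cast_sum, ← card_eq_sum_card_fiberwise]
    intro x hx
    have h9 := hXd x hx
    have h10 : (#x : ℝ) < n := by linarith
    simpa using h10
  have hpn : p n ≤ 1 := by
    have : #(E.filter fun s => #s = n) ≤ 1 := by
      refine (card_le_card (t := powersetCard n univ) fun s hs => ?_).trans (by simp)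
      simpa using (mem_filter.1 hs).2
    simp only [hp, Nat.choose_self, Nat.cast_one, div_one]
    exact_mod_cast this
  have hp0 : 0 ≤ p 0 := by positivity
  rw [← sum_div, ← mul_sum, ← hfiber, div_le_iff₀ hN0] at hsum
  nlinarith

end Antichains

/-! ### Containers for maximal antichains -/

section MaxAntichains

variable {n : ℕ}

/-- Exponential tilting with weight 3^|s|, of total 4^n: a set of size above 3n/4 weighs at least
(9/4)^n, because (9/4)^4 ≤ 27. -/
theorem card_large_sets_le (n : ℕ) :
    (#((univ : Finset (Finset (Fin n))).filter fun s => ¬ 4 * #s ≤ 3 * n) : ℝ) ≤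
      (16 / 9 : ℝ) ^ n := by
  have h1 : ∑ s : Finset (Fin n), (3 : ℝ) ^ #s = 4 ^ n := by
    have := Finset.sum_pow_mul_eq_add_pow (3 : ℝ) 1 (univ : Finset (Fin n))
    simp only [one_pow, mul_one, powerset_univ, card_univ, Fintype.card_fin] at this
    rw [this]
    norm_num
  have h2 : ∀ s ∈ (univ : Finset (Finset (Fin n))).filter fun s => ¬ 4 * #s ≤ 3 * n,
      (9 / 4 : ℝ) ^ n ≤ 3 ^ #s := by
    intro s hs
    have hs' : 3 * n ≤ 4 * #s := by
      have := (mem_filter.1 hs).2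
      omega
    rw [← pow_le_pow_iff_left₀ (by positivity) (by positivity) (four_ne_zero)]
    calc ((9 / 4 : ℝ) ^ n) ^ 4 = ((9 / 4 : ℝ) ^ 4) ^ n := by rw [← pow_mul, ← pow_mul, mul_comm]
      _ ≤ (3 ^ 3 : ℝ) ^ n := by
        gcongr
        norm_num
      _ = 3 ^ (3 * n) := by rw [← pow_mul]
      _ ≤ 3 ^ (4 * #s) := pow_le_pow_right₀ (by norm_num) hs'
      _ = (3 ^ #s) ^ 4 := by rw [← pow_mul, mul_comm]
  have h3 := card_nsmul_le_sum _ _ _ h2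
  have h4 := h3.trans (sum_le_univ_sum_of_nonneg fun s => by positivity)
  rw [h1, nsmul_eq_mul, ← le_div_iff₀ (by positivity), ← div_pow] at h4
  refine h4.trans_eq ?_
  norm_num

/-- An antichain is encoded by its large members J, a fingerprint S of the rest, and the rest as a
maximal antichain of the container `X (J, S)`. The cutoff 3n/4 leaves at least n/4 covers above each
remaining set, well above φ in the application. -/
theorem card_maxIndep_comparabilityGraph_le {φ c : ℕ} (hφ0 : 0 < φ)
    (hc : ∀ X : Finset (Finset (Fin n)), (X : Set (Finset (Fin n))).OrdConnected →
      (∀ x ∈ X, 4 * #x ≤ 3 * n) → (∀ x ∈ X, #(X.filter fun y => x < y) ≤ φ) →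
      #(maxIndep (comparabilityGraph (Finset (Fin n))) X) ≤ c) :
    #(maxIndep (comparabilityGraph (Finset (Fin n))) univ) ≤
      2 ^ #((univ : Finset (Finset (Fin n))).filter fun s => ¬ 4 * #s ≤ 3 * n) *
        #((univ : Finset (Finset (Fin n))).powerset.filter fun S => #S ≤ 2 ^ n / φ) * c := by
  classical
  set G := comparabilityGraph (Finset (Fin n)) with hG
  set Z : Finset (Finset (Fin n)) → Finset (Finset (Fin n)) :=
    fun J => univ.filter fun x => 4 * #x ≤ 3 * n ∧ ∀ u ∈ J, ¬ G.Adj u x with hZ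
  set N : Finset (Finset (Fin n)) → Finset (Fin n) → Finset (Finset (Fin n)) :=
    fun J u => (Z J).filter fun y => u < y with hN
  set X : Finset (Finset (Fin n)) × Finset (Finset (Fin n)) → Finset (Finset (Fin n)) :=
    fun q => (Z (q.1 ∪ q.2)).filter fun x =>
      #((Z (q.1 ∪ q.2)).filter fun y => x < y) ≤ φ with hX
  have hZmem : ∀ J x, x ∈ Z J ↔ 4 * #x ≤ 3 * n ∧ ∀ u ∈ J, ¬ G.Adj u x := by simp [hZ]
  have hZconv : ∀ J, (Z J : Set (Finset (Fin n))).OrdConnected := by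
    refine fun J => ⟨fun x hx z hz y hy => ?_⟩
    rw [mem_coe, hZmem] at hx hz ⊢
    refine ⟨(Nat.mul_le_mul_left 4 (card_le_card hy.2)).trans hz.1, fun u hu => ?_⟩
    rintro (h | h)
    · exact hz.2 u hu (Or.inl (h.trans_le hy.2))
    · exact hx.2 u hu (Or.inr (lt_of_le_of_lt hy.1 h))
  have hXconv : ∀ q, (X q : Set (Finset (Fin n))).OrdConnected := by
    refine fun q => ⟨fun x hx z hz y hy => ?_⟩
    rw [mem_coe, mem_filter] at hx hz ⊢
    refine ⟨(hZconv _).out hx.1 hz.1 hy, le_trans (card_le_card fun w hw => ?_) hx.2⟩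
    rw [mem_filter] at hw ⊢
    exact ⟨hw.1, lt_of_le_of_lt hy.1 hw.2⟩
  set Out := (univ : Finset (Finset (Fin n))).filter fun s => ¬ 4 * #s ≤ 3 * n with hOut
  set Sm := (univ : Finset (Finset (Fin n))).powerset.filter fun S => #S ≤ 2 ^ n / φ with hSm
  have hcover : maxIndep G univ ⊆
      (Out.powerset ×ˢ Sm).biUnion fun q => (maxIndep G (X q)).image fun I => q.1 ∪ I := by
    intro I hI
    obtain ⟨-, hind, hmax⟩ := mem_maxIndep.1 hI
    set J := I.filter fun s => ¬ 4 * #s ≤ 3 * n with hJ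
    set I' := I.filter fun s => 4 * #s ≤ 3 * n with hI'
    have hJI' : J ∪ I' = I := by rw [union_comm, hI', hJ, filter_union_filter_not_eq]
    obtain ⟨S, hSI, hcard, hsmall⟩ := exists_fingerprint (N J) I' hφ0
    have hSI' : S ⊆ I := hSI.trans (filter_subset _ _)
    have hIX : I' ⊆ X (J, S) := by
      intro x hx
      obtain ⟨hxI, hxm⟩ := mem_filter.1 hx
      refine mem_filter.2 ⟨(hZmem _ _).2 ⟨hxm, fun u hu => ?_⟩, ?_⟩
      · rcases mem_union.1 hu with hu | hu
        · exact hind u (mem_filter.1 hu).1 x hxI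
        · exact hind u (hSI' hu) x hxI
      · refine le_trans (card_le_card fun y hy => ?_) (hsmall x hx).le
        obtain ⟨hyZ, hxy⟩ := mem_filter.1 hy
        rw [hZmem] at hyZ
        refine mem_sdiff.2 ⟨mem_filter.2 ⟨(hZmem _ _).2
          ⟨hyZ.1, fun u hu => hyZ.2 u (mem_union_left _ hu)⟩, hxy⟩, ?_⟩
        rw [mem_biUnion]
        rintro ⟨s, hs, hsy⟩
        exact hyZ.2 s (mem_union_right _ hs) (Or.inl (mem_filter.1 hsy).2)
    rw [mem_biUnion]
    refine ⟨(J, S), mem_product.2 ⟨?_, ?_⟩, mem_image.2 ⟨I', mem_maxIndep.2 ⟨hIX, ?_, ?_⟩, hJI'⟩⟩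
    · exact mem_powerset.2 fun s hs => mem_filter.2 ⟨mem_univ _, (mem_filter.1 hs).2⟩
    · refine mem_filter.2 ⟨by simp, ?_⟩
      rw [Nat.le_div_iff_mul_le hφ0, mul_comm]
      refine hcard.trans ((card_le_univ _).trans_eq ?_)
      simp
    · exact fun x hx y hy => hind x (mem_filter.1 hx).1 y (mem_filter.1 hy).1
    · intro x hx hxI
      have hxZ := (hZmem _ _).1 (mem_filter.1 hx).1
      -- The blocking y cannot be one of the large members, since the container avoids everything
      -- comparable to them.
      obtain ⟨y, hy, hxy⟩ := hmax x (mem_univ _) fun h => hxI (mem_filter.2 ⟨h, hxZ.1⟩)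
      refine ⟨y, ?_, hxy⟩
      rcases mem_union.1 (hJI'.symm ▸ hy : y ∈ J ∪ I') with h | h
      · exact absurd hxy.symm (hxZ.2 y (mem_union_left _ h))
      · exact h
  refine (card_le_card hcover).trans ((card_biUnion_le_card_mul _ _ c fun q _ => ?_).trans_eq ?_)
  · refine card_image_le.trans (hc _ (hXconv q) (fun x hx => ?_) fun x hx => ?_)
    · exact ((hZmem _ _).1 (mem_filter.1 hx).1).1
    · exact le_trans (card_le_card (filter_subset_filter _ (filter_subset _ _)))
        (mem_filter.1 hx).2
  · rw [card_product, card_powerset]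

theorem logb_numMaxAntichains_le {φ : ℕ} (hn : 1 ≤ n) (hφ0 : 0 < φ) (hφ : (φ : ℝ) < n / 4) :
    Real.logb 2 (numMaxAntichains (Finset (Fin n))) ≤
      (16 / 9) ^ n + (2 * 2 ^ n / n + (2 ^ n / φ : ℝ) * Real.logb 2 n) +
        n.choose (n / 2) / (1 - φ / (n / 4)) / 2 := by
  classical
  set R : ℝ := n.choose (n / 2) / (1 - φ / (n / 4)) with hR
  have hd : 0 < 1 - φ / (n / 4 : ℝ) := by
    rw [sub_pos, div_lt_one (lt_of_le_of_lt (Nat.cast_nonneg φ) hφ)]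
    exact hφ
  have hR0 : 0 ≤ R := by positivity
  -- The integer square root is the natural-number form of the bound 2^(R/2).
  have hc : ∀ X : Finset (Finset (Fin n)), (X : Set (Finset (Fin n))).OrdConnected →
      (∀ x ∈ X, 4 * #x ≤ 3 * n) → (∀ x ∈ X, #(X.filter fun y => x < y) ≤ φ) →
      #(maxIndep (comparabilityGraph (Finset (Fin n))) X) ≤ Nat.sqrt (2 ^ ⌊R⌋₊) := by
    intro X hX hXm hdeg
    rw [Nat.le_sqrt']
    refine (card_maxIndep_sq_le_of_ordConnected X hX).trans (Nat.pow_le_pow_right two_pos ?_)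
    refine Nat.le_floor ?_
    rw [hR, le_div_iff₀ hd, mul_comm]
    refine card_le_of_ordConnected hX hdeg hφ fun x hx => ?_
    have : (4 * #x : ℝ) ≤ 3 * n := by exact_mod_cast hXm x hx
    linarith
  have h1 := card_maxIndep_comparabilityGraph_le hφ0 hc
  have h2 := logb_card_small_subsets_le (univ : Finset (Finset (Fin n))) (m := 2 ^ n / φ)
    (c := 2 ^ n / φ) (Nat.cast_div_le.trans_eq (by simp)) hn
  rw [card_univ, Fintype.card_finset, Fintype.card_fin, Nat.cast_pow, Nat.cast_ofNat] at h2
  have h3 := card_large_sets_le n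
  have h4 : (0 : ℝ) < #((univ : Finset (Finset (Fin n))).powerset.filter
      fun S => #S ≤ 2 ^ n / φ) := by
    exact_mod_cast card_pos.2 ⟨∅, by simp⟩
  have h5 : (0 : ℝ) < Nat.sqrt (2 ^ ⌊R⌋₊) := by
    exact_mod_cast Nat.sqrt_pos.2 (by positivity)
  have h6 : Real.logb 2 (Nat.sqrt (2 ^ ⌊R⌋₊)) ≤ R / 2 := by
    have h7 : ((Nat.sqrt (2 ^ ⌊R⌋₊) : ℕ) : ℝ) ^ 2 ≤ 2 ^ ⌊R⌋₊ := by
      exact_mod_cast Nat.sqrt_le' (2 ^ ⌊R⌋₊)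
    have h8 := Real.logb_le_logb_of_le one_lt_two (by positivity) h7
    rw [Real.logb_pow, Real.logb_pow, Real.logb_self_eq_one one_lt_two, mul_one] at h8
    have h9 := Nat.floor_le hR0
    push_cast at h8
    linarith
  rw [numMaxAntichains_eq_mis, mis_eq_card_maxIndep_univ]
  set O := #((univ : Finset (Finset (Fin n))).filter fun s => ¬ 4 * #s ≤ 3 * n)
  set Q := #((univ : Finset (Finset (Fin n))).powerset.filter fun S => #S ≤ 2 ^ n / φ)
  calc Real.logb 2 #(maxIndep (comparabilityGraph (Finset (Fin n))) univ)
      ≤ Real.logb 2 (2 ^ O * Q * Nat.sqrt (2 ^ ⌊R⌋₊)) := by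
        refine Real.logb_le_logb_of_le one_lt_two ?_ (by exact_mod_cast h1)
        exact_mod_cast card_maxIndep_pos _ _
    _ = O + Real.logb 2 Q + Real.logb 2 (Nat.sqrt (2 ^ ⌊R⌋₊)) := by
        rw [Real.logb_mul (by positivity) h5.ne', Real.logb_mul (by positivity) h4.ne',
          Real.logb_pow, Real.logb_self_eq_one one_lt_two, mul_one]
    _ ≤ _ := add_le_add (add_le_add h3 h2) h6

theorem choose_le_logb_numMaxAntichains (n k : ℕ) :
    (n.choose k : ℝ) ≤ Real.logb 2 (numMaxAntichains (Finset (Fin (n + 1)))) := by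
  rw [numMaxAntichains_eq_mis, mis_eq_card_maxIndep_univ]
  refine le_logb_card_maxIndep ?_
  have hcard : #(powersetCard k ((univ : Finset (Fin (n + 1))).erase 0)) = n.choose k := by
    rw [card_powersetCard, card_erase_of_mem (mem_univ _)]
    simp
  have h0 : ∀ s ∈ powersetCard k ((univ : Finset (Fin (n + 1))).erase 0), 0 ∉ s := by
    intro s hs h
    simpa using (mem_powersetCard.1 hs).1 h
  have hlev : ∀ s t : Finset (Fin (n + 1)), #s = #t →
      ¬ (comparabilityGraph (Finset (Fin (n + 1)))).Adj s t := by
    rintro s t h (hst | hst) <;> have := card_lt_card hst <;> omega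
  have hc : ∀ s ∈ powersetCard k ((univ : Finset (Fin (n + 1))).erase 0),
      #(insert 0 s) = k + 1 := by
    intro s hs
    rw [card_insert_of_notMem (h0 s hs), (mem_powersetCard.1 hs).2]
  rw [← hcard]
  refine two_pow_le_card_maxIndep _ id (insert 0) (by simp) (by simp) ?_ ?_ ?_
  · intro s hs t ht
    have hst : #s = #t := (mem_powersetCard.1 hs).2.trans (mem_powersetCard.1 ht).2.symm
    rw [comparabilityGraph_adj]
    constructor
    · rintro (h | h)
      · refine eq_of_subset_of_card_le ?_ hst.ge
        exact (subset_insert_iff_of_notMem (h0 s hs)).1 h.le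
      · exact absurd (h.le (mem_insert_self 0 t)) (h0 s hs)
    · rintro rfl
      exact Or.inl (ssubset_insert (h0 s hs))
  · intro s hs t ht
    exact hlev _ _ ((mem_powersetCard.1 hs).2.trans (mem_powersetCard.1 ht).2.symm)
  · intro s hs t ht
    exact hlev _ _ ((hc s hs).trans (hc t ht).symm)

end MaxAntichains

/-! ### Binomial estimates and limits -/

section Asymptotics

/-- The induction step reduces to 4j(j + 1) ≤ (2j + 1)². The resulting loss of order √n against 2^n
is affordable, because fingerprints for antichains cost about 2^n log n / n bits. -/
theorem four_pow_sq_le_mul_centralBinom_sq {j : ℕ} (hj : 1 ≤ j) :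
    (4 ^ j) ^ 2 ≤ 4 * j * j.centralBinom ^ 2 := by
  induction j, hj using Nat.le_induction with
  | base => simp [Nat.centralBinom_eq_two_mul_choose]
  | succ j hj ih =>
    have h := Nat.succ_mul_centralBinom_succ j
    refine le_of_mul_le_mul_left (a := j + 1) ?_ (Nat.succ_pos j)
    calc (j + 1) * (4 ^ (j + 1)) ^ 2 = 16 * (j + 1) * (4 ^ j) ^ 2 := by ring
      _ ≤ 16 * (j + 1) * (4 * j * j.centralBinom ^ 2) := by gcongr
      _ = 16 * (4 * (j * (j + 1))) * j.centralBinom ^ 2 := by ring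
      _ ≤ 16 * (2 * j + 1) ^ 2 * j.centralBinom ^ 2 := by
        gcongr
        nlinarith
      _ = 4 * (2 * (2 * j + 1) * j.centralBinom) ^ 2 := by ring
      _ = 4 * ((j + 1) * (j + 1).centralBinom) ^ 2 := by rw [h]
      _ = (j + 1) * (4 * (j + 1) * (j + 1).centralBinom ^ 2) := by ring

theorem two_pow_le_sqrt_mul_choose {n : ℕ} (hn : 1 ≤ n) :
    (2 : ℝ) ^ n ≤ 4 * √n * (n - 1).choose (n / 2) := by
  have hsq : (2 ^ n) ^ 2 ≤ 16 * n * (n - 1).choose (n / 2) ^ 2 := by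
    rcases Nat.even_or_odd' n with ⟨j, rfl | rfl⟩
    · have hj : 1 ≤ j := by omega
      have h1 := four_pow_sq_le_mul_centralBinom_sq hj
      have h2 : j.centralBinom = 2 * (2 * j - 1).choose j := by
        obtain ⟨i, rfl⟩ : ∃ i, j = i + 1 := ⟨j - 1, by omega⟩
        have h3 : 2 * (i + 1) = (2 * i + 1) + 1 := by ring
        rw [Nat.centralBinom_eq_two_mul_choose, h3, Nat.add_sub_cancel, Nat.choose_succ_succ,
          ← Nat.choose_symm_half]
        ring
      rw [show 2 * j / 2 = j by omega, pow_mul]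
      rw [h2] at h1
      norm_num at h1 ⊢
      nlinarith [sq_nonneg ((2 * j - 1).choose j)]
    · rw [show (2 * j + 1) / 2 = j by omega, Nat.add_sub_cancel,
        ← Nat.centralBinom_eq_two_mul_choose]
      rcases Nat.eq_zero_or_pos j with rfl | hj
      · norm_num
      · have h1 := four_pow_sq_le_mul_centralBinom_sq hj
        rw [pow_succ 2 (2 * j), pow_mul]
        norm_num at h1 ⊢
        nlinarith [sq_nonneg j.centralBinom]
  have h : ((2 : ℝ) ^ n) ^ 2 ≤ (4 * √n * (n - 1).choose (n / 2)) ^ 2 := by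
    rw [mul_pow, mul_pow, Real.sq_sqrt (Nat.cast_nonneg n)]
    norm_num1
    exact_mod_cast hsq
  exact le_of_sq_le_sq h (by positivity)

theorem choose_mul_sub_eq {n k : ℕ} (hk : k < n) :
    (n.choose k : ℝ) * (n - k) = n * (n - 1).choose k := by
  obtain ⟨m, rfl⟩ : ∃ m, n = m + 1 := ⟨n - 1, by omega⟩
  have h := Nat.choose_mul_succ_eq m k
  rw [← Nat.cast_sub hk.le, Nat.add_sub_cancel, mul_comm ((m + 1 : ℕ) : ℝ)]
  exact_mod_cast h.symm

theorem choose_succ_mul_eq {n k : ℕ} (hk : k < n) :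
    (n.choose (k + 1) : ℝ) * (k + 1) = n * (n - 1).choose k := by
  obtain ⟨m, rfl⟩ : ∃ m, n = m + 1 := ⟨n - 1, by omega⟩
  have h := Nat.add_one_mul_choose_eq m k
  rw [Nat.add_sub_cancel]
  exact_mod_cast h.symm

theorem choose_half_le {n : ℕ} (hn : 1 ≤ n) :
    (n.choose (n / 2) : ℝ) ≤ 2 * (n - 1).choose (n / 2) := by
  have h := choose_mul_sub_eq (show n / 2 < n by omega)
  have h1 : (n : ℝ) ≤ 2 * (n - (n / 2 : ℕ)) := by
    have : 2 * ((n / 2 : ℕ) : ℝ) ≤ n := by exact_mod_cast Nat.mul_div_le n 2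
    linarith
  have hn' : (0 : ℝ) < n := by exact_mod_cast hn
  refine le_of_mul_le_mul_right ?_ hn'
  calc (n.choose (n / 2) : ℝ) * n ≤ n.choose (n / 2) * (2 * (n - (n / 2 : ℕ))) := by gcongr
    _ = 2 * (n.choose (n / 2) * (n - (n / 2 : ℕ))) := by ring
    _ = _ := by
      rw [h]
      ring

theorem tendsto_logb_div_sqrt :
    Tendsto (fun n : ℕ => Real.logb 2 n / √n) atTop (nhds 0) := by
  have h : (fun x : ℝ => Real.log x) =o[atTop] fun x => x ^ (1 / 2 : ℝ) :=
    isLittleO_log_rpow_atTop (by norm_num)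
  have h1 := (h.tendsto_div_nhds_zero.comp tendsto_natCast_atTop_atTop).div_const (Real.log 2)
  rw [zero_div] at h1
  refine h1.congr fun n => ?_
  simp only [Function.comp, Real.logb, Real.sqrt_eq_rpow]
  rw [div_right_comm]

theorem tendsto_logb_div :
    Tendsto (fun n : ℕ => Real.logb 2 n / n) atTop (nhds 0) := by
  have h1 := (Real.isLittleO_log_id_atTop.tendsto_div_nhds_zero.comp
    tendsto_natCast_atTop_atTop).div_const (Real.log 2)
  rw [zero_div] at h1
  refine h1.congr fun n => ?_
  simp only [Function.comp, Real.logb, id]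
  rw [div_right_comm]

theorem tendsto_inv_sqrt : Tendsto (fun n : ℕ => (√n)⁻¹) atTop (nhds 0) :=
  (Real.tendsto_sqrt_atTop.comp tendsto_natCast_atTop_atTop).inv_tendsto_atTop

theorem tendsto_sqrt_mul_pow : Tendsto (fun n : ℕ => √n * (8 / 9 : ℝ) ^ n) atTop (nhds 0) := by
  have h := tendsto_self_mul_const_pow_of_lt_one (r := (8 / 9 : ℝ)) (by norm_num) (by norm_num)
  refine squeeze_zero (fun n => by positivity) (fun n => ?_) h
  have h1 : √n ≤ n := by
    rw [Real.sqrt_le_left (Nat.cast_nonneg n)]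
    exact_mod_cast Nat.le_self_pow two_ne_zero n
  gcongr

end Asymptotics

/-! ### Choice of parameters and conclusion -/

section Main

theorem isEquivalent_of_forall_eventually {u v : ℕ → ℝ} (hv : ∀ᶠ n in atTop, 0 ≤ v n)
    (hl : ∀ᶠ n in atTop, v n ≤ u n)
    (hu : ∀ ε : ℝ, 0 < ε → ∀ᶠ n in atTop, u n ≤ (1 + ε) * v n) : u ~[atTop] v := by
  rw [IsEquivalent, isLittleO_iff]
  intro ε hε
  filter_upwards [hv, hl, hu ε hε] with n h1 h2 h3
  rw [Pi.sub_apply, Real.norm_of_nonneg (by linarith), Real.norm_of_nonneg h1]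
  linarith

theorem ceil_mul_le {δ : ℝ} {n : ℕ} (h : 1 ≤ δ * n) : (⌈δ * n⌉₊ : ℝ) ≤ 2 * δ * n := by
  have := (Nat.ceil_lt_add_one (show 0 ≤ δ * n by linarith)).le
  linarith

theorem eventually_one_le_mul {δ : ℝ} (hδ : 0 < δ) : ∀ᶠ n : ℕ in atTop, 1 ≤ δ * n :=
  (tendsto_natCast_atTop_atTop.const_mul_atTop hδ).eventually_ge_atTop 1

theorem eventually_logb_mis_cubeGraph_le {ε : ℝ} (hε : 0 < ε) :
    ∀ᶠ n : ℕ in atTop, Real.logb 2 (mis (cubeGraph n)) ≤ (1 + ε) * 2 ^ ((n : ℤ) - 2) := by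
  set δ := ε / 4 with hδ
  have hδ0 : 0 < δ := by positivity
  have herr : Tendsto (fun n : ℕ => 4 * ((n : ℝ)⁻¹) + 2 / δ * (Real.logb 2 n / n)) atTop
      (nhds (4 * 0 + 2 / δ * 0)) :=
    (tendsto_inv_atTop_nhds_zero_nat.const_mul _).add (tendsto_logb_div.const_mul _)
  rw [mul_zero, mul_zero, add_zero] at herr
  filter_upwards [herr.eventually_le_const (show 0 < ε / 2 by positivity),
    eventually_one_le_mul hδ0, eventually_ge_atTop 1] with n h1 h2 hn
  have hn0 : (0 : ℝ) < n := by exact_mod_cast hn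
  have hδn : 0 < δ * n := by linarith
  have hφ : 0 < ⌈δ * n⌉₊ := Nat.ceil_pos.2 hδn
  have h3 := logb_mis_cubeGraph_le hn hφ
  set φ := ⌈δ * n⌉₊
  have hφ1 : δ * n ≤ φ := Nat.le_ceil _
  have hφ2 : (φ : ℝ) ≤ 2 * δ * n := ceil_mul_le h2
  have hlog : 0 ≤ Real.logb 2 n := Real.logb_nonneg one_lt_two (by exact_mod_cast hn)
  set P : ℝ := 2 ^ ((n : ℤ) - 2) with hP
  have hP0 : 0 < P := by positivity
  have hpow : (2 : ℝ) ^ (n - 1) = 2 * P := by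
    rw [hP, ← zpow_natCast, ← zpow_one_add₀ two_ne_zero, Nat.cast_sub hn]
    congr 1
    push_cast
    ring
  rw [hpow] at h3
  have hA : 2 * (2 * P) / n = P * (4 * (n : ℝ)⁻¹) := by
    field_simp
    ring
  have hB : 2 * P / φ * Real.logb 2 n ≤ P * (2 / δ * (Real.logb 2 n / n)) := by
    calc 2 * P / φ * Real.logb 2 n ≤ 2 * P / (δ * n) * Real.logb 2 n := by gcongr
      _ = _ := by field_simp
  have hC : (n * (2 * P) + φ * (2 * P)) / (n + n) ≤ P * (1 + 2 * δ) := by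
    rw [div_le_iff₀ (by positivity)]
    have : (φ : ℝ) * (2 * P) ≤ 2 * δ * n * (2 * P) := by gcongr
    linarith
  have hD : P * (4 * (n : ℝ)⁻¹ + 2 / δ * (Real.logb 2 n / n)) ≤ P * (ε / 2) := by gcongr
  have h2δ : 2 * δ = ε / 2 := by
    rw [hδ]
    ring
  rw [h2δ] at hC
  linarith

theorem eventually_logb_mis_cubeLevels_le {ε : ℝ} (hε : 0 < ε) (hε1 : ε ≤ 1) :
    ∀ᶠ n : ℕ in atTop, ∀ k < n,
      Real.logb 2 (mis (cubeLevels n k)) ≤ (1 + ε) * (n - 1).choose k := by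
  set δ := ε / 4 with hδ
  have hδ0 : 0 < δ := by positivity
  have hδ1 : δ ≤ 1 / 4 := by linarith
  have herr : Tendsto (fun n : ℕ => 2 / δ * ((n : ℝ)⁻¹) + 1 / δ ^ 3 * (Real.logb 2 n / n)) atTop
      (nhds (2 / δ * 0 + 1 / δ ^ 3 * 0)) :=
    (tendsto_inv_atTop_nhds_zero_nat.const_mul _).add (tendsto_logb_div.const_mul _)
  rw [mul_zero, mul_zero, add_zero] at herr
  filter_upwards [herr.eventually_le_const (show 0 < ε / 2 by positivity),
    eventually_one_le_mul (show 0 < δ ^ 2 by positivity), eventually_ge_atTop 1]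
    with n h1 h2 hn k hk
  have hn0 : (0 : ℝ) < n := by exact_mod_cast hn
  have hk' : (k : ℝ) + 1 ≤ n := by exact_mod_cast hk
  have hup := choose_mul_sub_eq hk
  have hdown := choose_succ_mul_eq hk
  obtain ⟨htriv1, htriv2⟩ := logb_mis_cubeLevels_le_choose n k
  set T : ℝ := (((n - 1).choose k : ℕ) : ℝ) with hT
  have hT0 : 0 ≤ T := Nat.cast_nonneg _
  have hcoef : (1 : ℝ) ≤ (1 + ε) * (1 - δ) := by
    rw [hδ]
    nlinarith
  -- Near either end one of the two levels has size at most T / (1 - δ), and recording the trace on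
  -- it suffices.
  by_cases hcase1 : (k : ℝ) + 1 ≤ δ * n
  · refine htriv1.trans ?_
    have hnk : (1 - δ) * n ≤ n - k := by linarith
    refine le_of_mul_le_mul_right ?_ (show (0 : ℝ) < n - k by linarith)
    calc (n.choose k : ℝ) * (n - k) = 1 * (n * T) := by rw [hup, one_mul]
      _ ≤ (1 + ε) * (1 - δ) * (n * T) := by gcongr
      _ = (1 + ε) * T * ((1 - δ) * n) := by ring
      _ ≤ _ := by gcongr
  by_cases hcase2 : (n : ℝ) - k ≤ δ * n
  · refine htriv2.trans ?_
    have hnk : (1 - δ) * n ≤ k + 1 := by linarith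
    refine le_of_mul_le_mul_right ?_ (show (0 : ℝ) < k + 1 by positivity)
    calc (n.choose (k + 1) : ℝ) * (k + 1) = 1 * (n * T) := by rw [hdown, one_mul]
      _ ≤ (1 + ε) * (1 - δ) * (n * T) := by gcongr
      _ = (1 + ε) * T * ((1 - δ) * n) := by ring
      _ ≤ _ := by gcongr
  push Not at hcase1 hcase2
  have hδn : 0 < δ ^ 2 * n := by linarith
  -- The choice is δ²n, not δn, because in the middle range the levels are only known to have size
  -- at most T / δ; the term with φ then contributes at most 2δT.
  have hφ : 0 < ⌈δ ^ 2 * n⌉₊ := Nat.ceil_pos.2 hδn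
  have h3 := logb_mis_cubeLevels_le (k := k) hn hφ
  set φ := ⌈δ ^ 2 * n⌉₊
  have hφ1 : δ ^ 2 * n ≤ φ := Nat.le_ceil _
  have hφ2 : (φ : ℝ) ≤ 2 * δ ^ 2 * n := ceil_mul_le h2
  have hlog : 0 ≤ Real.logb 2 n := Real.logb_nonneg one_lt_two (by exact_mod_cast hn)
  rw [Nat.cast_sub hk.le, Nat.cast_add, Nat.cast_one] at h3
  have hck : (n.choose k : ℝ) ≤ T / δ := by
    rw [le_div_iff₀ hδ0]
    refine le_of_mul_le_mul_right ?_ hn0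
    calc (n.choose k : ℝ) * δ * n = n.choose k * (δ * n) := by ring
      _ ≤ n.choose k * (n - k) := by gcongr
      _ = T * n := by rw [hup, mul_comm]
  have hck1 : (n.choose (k + 1) : ℝ) ≤ T / δ := by
    rw [le_div_iff₀ hδ0]
    refine le_of_mul_le_mul_right ?_ hn0
    calc (n.choose (k + 1) : ℝ) * δ * n = n.choose (k + 1) * (δ * n) := by ring
      _ ≤ n.choose (k + 1) * (k + 1) := by gcongr
      _ = T * n := by rw [hdown, mul_comm]
  have hA : 2 * (n.choose k : ℝ) / n ≤ T * (2 / δ * (n : ℝ)⁻¹) := by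
    calc 2 * (n.choose k : ℝ) / n ≤ 2 * (T / δ) / n := by gcongr
      _ = _ := by field_simp
  have hB : n.choose (k + 1) / φ * Real.logb 2 n ≤ T * (1 / δ ^ 3 * (Real.logb 2 n / n)) := by
    calc n.choose (k + 1) / φ * Real.logb 2 n
        ≤ (T / δ) / (δ ^ 2 * n) * Real.logb 2 n := by gcongr
      _ = _ := by field_simp
  have hC : ((k + 1) * n.choose (k + 1) + φ * n.choose k : ℝ) / (n - k + (k + 1)) ≤
      T * (1 + 2 * δ) := by
    rw [div_le_iff₀ (by linarith)]
    have e1 : (φ : ℝ) * n.choose k ≤ 2 * δ ^ 2 * n * (T / δ) := by gcongr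
    have e2 : 2 * δ ^ 2 * n * (T / δ) = 2 * δ * n * T := by field_simp
    have e3 : 0 ≤ T * (1 + 2 * δ) := by positivity
    linarith
  have hD : T * (2 / δ * (n : ℝ)⁻¹ + 1 / δ ^ 3 * (Real.logb 2 n / n)) ≤ T * (ε / 2) := by gcongr
  have h2δ : 2 * δ = ε / 2 := by
    rw [hδ]
    ring
  rw [h2δ] at hC
  linarith

theorem eventually_logb_numMaxAntichains_le {ε : ℝ} (hε : 0 < ε) (hε1 : ε ≤ 1) :
    ∀ᶠ n : ℕ in atTop, Real.logb 2 (numMaxAntichains (Finset (Fin n))) ≤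
      (1 + ε) * (n - 1).choose (n / 2) := by
  -- This makes φ / (n/4) ≤ 8δ = ε/4, and (1 + ε/2)(1 - ε/4) ≥ 1.
  set δ := ε / 32 with hδ
  have hδ0 : 0 < δ := by positivity
  have herr : Tendsto (fun n : ℕ => 4 * (√n * (8 / 9 : ℝ) ^ n) + 8 * (√n)⁻¹ +
      4 / δ * (Real.logb 2 n / √n)) atTop (nhds (4 * 0 + 8 * 0 + 4 / δ * 0)) :=
    ((tendsto_sqrt_mul_pow.const_mul _).add (tendsto_inv_sqrt.const_mul _)).add
      (tendsto_logb_div_sqrt.const_mul _)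
  rw [mul_zero, mul_zero, mul_zero, add_zero, add_zero] at herr
  filter_upwards [herr.eventually_le_const (show 0 < ε / 2 by positivity),
    eventually_one_le_mul hδ0, eventually_ge_atTop 1] with n h1 h2 hn
  have hn0 : (0 : ℝ) < n := by exact_mod_cast hn
  have hδn : 0 < δ * n := by linarith
  have hφ : 0 < ⌈δ * n⌉₊ := Nat.ceil_pos.2 hδn
  have hφ2 : (⌈δ * n⌉₊ : ℝ) ≤ 2 * δ * n := ceil_mul_le h2
  have hφ3 : (⌈δ * n⌉₊ : ℝ) < n / 4 := by
    refine hφ2.trans_lt ?_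
    have : 2 * δ * n ≤ 1 / 16 * n := by
      gcongr
      linarith
    linarith
  have h3 := logb_numMaxAntichains_le hn hφ hφ3
  set φ := ⌈δ * n⌉₊
  have hφ1 : δ * n ≤ φ := Nat.le_ceil _
  have hlog : 0 ≤ Real.logb 2 n := Real.logb_nonneg one_lt_two (by exact_mod_cast hn)
  have hpow := two_pow_le_sqrt_mul_choose hn
  have hhalf := choose_half_le hn
  set T : ℝ := (((n - 1).choose (n / 2) : ℕ) : ℝ) with hT
  have hT0 : 0 ≤ T := Nat.cast_nonneg _
  have hs : 0 < √(n : ℝ) := Real.sqrt_pos.2 hn0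
  have hss : √(n : ℝ) * √n = n := Real.mul_self_sqrt hn0.le
  have hA : (16 / 9 : ℝ) ^ n ≤ T * (4 * (√n * (8 / 9 : ℝ) ^ n)) := by
    calc (16 / 9 : ℝ) ^ n = 2 ^ n * (8 / 9) ^ n := by
          rw [← mul_pow]
          norm_num
      _ ≤ 4 * √n * T * (8 / 9) ^ n := by gcongr
      _ = _ := by ring
  have hB : 2 * (2 : ℝ) ^ n / n ≤ T * (8 * (√n)⁻¹) := by
    rw [div_le_iff₀ hn0]
    calc 2 * (2 : ℝ) ^ n ≤ 2 * (4 * √n * T) := by gcongr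
      _ = T * (8 * (√n)⁻¹) * (√n * √n) := by
        field_simp
        ring
      _ = _ := by rw [hss]
  have hC : (2 : ℝ) ^ n / φ * Real.logb 2 n ≤ T * (4 / δ * (Real.logb 2 n / √n)) := by
    calc (2 : ℝ) ^ n / φ * Real.logb 2 n
        ≤ (4 * √n * T) / (δ * (√n * √n)) * Real.logb 2 n := by
          rw [hss]
          gcongr
      _ = _ := by field_simp
  have hq : (φ : ℝ) / (n / 4) ≤ 8 * δ := by
    rw [div_le_iff₀ (by positivity)]
    linarith
  have hD : (n.choose (n / 2) : ℝ) / (1 - φ / (n / 4)) / 2 ≤ T * (1 + ε / 2) := by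
    have hpos : 0 < 1 - (φ : ℝ) / (n / 4) := by linarith
    rw [div_le_iff₀ two_pos, div_le_iff₀ hpos]
    have hcoef : 1 ≤ (1 + ε / 2) * (1 - (φ : ℝ) / (n / 4)) := by
      have e : 1 - ε / 4 ≤ 1 - (φ : ℝ) / (n / 4) := by linarith
      calc (1 : ℝ) ≤ (1 + ε / 2) * (1 - ε / 4) := by nlinarith
        _ ≤ _ := by gcongr
    calc (n.choose (n / 2) : ℝ) ≤ 2 * T * 1 := by linarith
      _ ≤ 2 * T * ((1 + ε / 2) * (1 - (φ : ℝ) / (n / 4))) := by gcongr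
      _ = _ := by ring
  have hE : T * (4 * (√n * (8 / 9 : ℝ) ^ n) + 8 * (√n)⁻¹ + 4 / δ * (Real.logb 2 n / √n)) ≤
      T * (ε / 2) := by gcongr
  linarith

theorem zpow_le_logb_mis_cubeGraph {n : ℕ} (hn : 2 ≤ n) :
    (2 : ℝ) ^ ((n : ℤ) - 2) ≤ Real.logb 2 (mis (cubeGraph n)) := by
  obtain ⟨m, rfl⟩ : ∃ m, n = m + 2 := ⟨n - 2, by omega⟩
  have h := two_pow_le_mis_cubeGraph m
  rw [mis_cubeGraph] at h ⊢
  have h1 := le_logb_card_maxIndep h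
  refine le_trans (le_of_eq ?_) h1
  rw [Nat.cast_pow, Nat.cast_ofNat, ← zpow_natCast]
  congr 1
  push_cast
  ring

theorem choose_le_logb_mis_cubeLevels {n k : ℕ} (hn : 1 ≤ n) :
    ((n - 1).choose k : ℝ) ≤ Real.logb 2 (mis (cubeLevels n k)) := by
  obtain ⟨m, rfl⟩ : ∃ m, n = m + 1 := ⟨n - 1, by omega⟩
  have h := two_pow_le_mis_cubeLevels m k
  rw [mis_cubeLevels] at h ⊢
  exact le_logb_card_maxIndep h

end Main

theorem theorem1 :
    ((fun n : ℕ => Real.logb 2 (numMaxAntichains (Finset (Fin n)))) ~[atTop]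
        fun n : ℕ => ((n - 1).choose (n / 2) : ℝ)) ∧
    ((fun n : ℕ => Real.logb 2 (mis (cubeGraph n))) ~[atTop]
        fun n : ℕ => (2 : ℝ) ^ ((n : ℤ) - 2)) ∧
    (∀ ε : ℝ, 0 < ε → ∃ N : ℕ, ∀ n : ℕ, N ≤ n → ∀ k : ℕ, k < n →
      |Real.logb 2 (mis (cubeLevels n k)) - ((n - 1).choose k : ℝ)| ≤
        ε * ((n - 1).choose k : ℝ)) := by
  refine ⟨isEquivalent_of_forall_eventually (Eventually.of_forall fun n => Nat.cast_nonneg _)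
    ?_ ?_, isEquivalent_of_forall_eventually (Eventually.of_forall fun n => by positivity)
    ?_ fun ε hε => eventually_logb_mis_cubeGraph_le hε, ?_⟩
  · filter_upwards [eventually_ge_atTop 1] with n hn
    obtain ⟨m, rfl⟩ : ∃ m, n = m + 1 := ⟨n - 1, by omega⟩
    exact choose_le_logb_numMaxAntichains m _
  · intro ε hε
    -- The upper estimate needs ε ≤ 1, so it is applied to `min ε 1`.
    filter_upwards [eventually_logb_numMaxAntichains_le (lt_min hε one_pos) (min_le_right ε 1)]
      with n h
    refine h.trans ?_
    gcongr
    exact min_le_left _ _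
  · filter_upwards [eventually_ge_atTop 2] with n hn
    exact zpow_le_logb_mis_cubeGraph hn
  · intro ε hε
    obtain ⟨N, hN⟩ := eventually_atTop.1
      (eventually_logb_mis_cubeLevels_le (lt_min hε one_pos) (min_le_right ε 1))
    refine ⟨N, fun n hn k hk => ?_⟩
    have h1 := hN n hn k hk
    have h2 := choose_le_logb_mis_cubeLevels (n := n) (k := k) (by omega)
    have h3 : min ε 1 * ((n - 1).choose k : ℝ) ≤ ε * (n - 1).choose k := by
      gcongr
      exact min_le_left _ _
    rw [abs_of_nonneg (by linarith)]
    linarith
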